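/- Let $(R,\mathfrak m)$ be a Noetherian local ring of dimension $d\ge 2$. Suppose that there is an injective $R$-linear map $R\hookrightarrow E$, where $E$ is a finitely generated maximal Cohen–Macaulay $R$-module, i.e. a nonzero finitely generated $R$-module with $\operatorname{depth} E=\dim E=\dim R$. If $R$ is not Cohen–Macaulay, then $e_1(J)<0$ for every parameter ideal $J$ of $R$. Here a parameter ideal of $R$ is an ideal $J\subseteq\mathfrak m$ that is generated by $d$ elements and satisfies $\lambda(R/J)<\infty$, where $\lambda$ denotes length, and $e_0(J),\dots,e_d(J)\in\mathbb Z$ are the Hilbert coefficients of $J$, i.e. the unique integers such that for all sufficiently large $n$ $$\lambda(R/J^n)=\sum_{i=0}^{d}(-1)^i e_i(J)\binom{n+d-i-1}{d-i}.$$ -/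

import Mathlib

namespace LocalHilbert

open IsLocalRing Filter

/-- The Krull dimension of a module (the dimension of its support) as a natural number.
It is finite for finitely generated modules over Noetherian local rings; the zero module and
modules of infinite dimension get the value `0`. -/
noncomputable def moduleDim (R M : Type*) [CommRing R] [AddCommGroup M] [Module R M] : ℕ :=
  ((Module.supportDim R M).unbotD 0).toNat

/-- The depth of a module over a local ring: the supremum of the lengths of the `M`-regular
sequences in the maximal ideal. It is used for nonzero modules only. -/
noncomputable def depth (R M : Type*) [CommRing R] [IsLocalRing R] [AddCommGroup M]
    [Module R M] : ℕ∞ :=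
  sSup {n : ℕ∞ | ∃ rs : List R, (rs.length : ℕ∞) = n ∧ (∀ r ∈ rs, r ∈ maximalIdeal R) ∧
    RingTheory.Sequence.IsRegular M rs}

/-- A finitely generated module `M` over a (Noetherian) local ring is Cohen–Macaulay if it is
zero or `depth M = dim M`. -/
def IsCohenMacaulayModule (R M : Type*) [CommRing R] [IsLocalRing R] [AddCommGroup M]
    [Module R M] : Prop :=
  Module.Finite R M ∧
    (Subsingleton M ∨ ((depth R M : ℕ∞) : WithBot ℕ∞) = Module.supportDim R M)

/-- A maximal Cohen–Macaulay module: a Cohen–Macaulay module with `dim M = dim R`.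
Such a module is nonzero, since the zero module has dimension `⊥`. -/
def IsMaximalCohenMacaulayModule (R M : Type*) [CommRing R] [IsLocalRing R] [AddCommGroup M]
    [Module R M] : Prop :=
  IsCohenMacaulayModule R M ∧ Module.supportDim R M = ringKrullDim R

/-- A local ring is Cohen–Macaulay if it is Cohen–Macaulay as a module over itself. -/
def IsCohenMacaulayLocalRing (R : Type*) [CommRing R] [IsLocalRing R] : Prop :=
  IsCohenMacaulayModule R R

/-- A parameter ideal for `M`: a proper ideal generated by `d = dim M` elements such that
`M / I M` has finite length. -/
def IsParameterIdeal (R M : Type*) [CommRing R] [IsLocalRing R] [AddCommGroup M] [Module R M]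
    (I : Ideal R) : Prop :=
  I ≤ maximalIdeal R ∧
  (∃ x : Fin (moduleDim R M) → R, I = Ideal.span (Set.range x)) ∧
  Module.length R (M ⧸ (I • ⊤ : Submodule R M)) ≠ ⊤

/-- `e 0, …, e d`, `d = dim M`, are the Hilbert coefficients of `I` with respect to `M`: for all
large `n`, the length of `M / I ^ n M` is finite and equal to
`∑ i ≤ d, (-1) ^ i * e i * C(n + d - i - 1, d - i)`. The sequence is extended by `0` beyond `d`. -/
def IsHilbertCoefficients (R M : Type*) [CommRing R] [AddCommGroup M] [Module R M]
    (I : Ideal R) (e : ℕ → ℤ) : Prop :=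
  (∀ i, moduleDim R M < i → e i = 0) ∧
  ∀ᶠ n : ℕ in atTop,
    Module.length R (M ⧸ (I ^ n • ⊤ : Submodule R M)) ≠ ⊤ ∧
    ((Module.length R (M ⧸ (I ^ n • ⊤ : Submodule R M))).toNat : ℤ) =
      ∑ i ∈ Finset.range (moduleDim R M + 1),
        (-1) ^ i * e i * ((n + (moduleDim R M - i) - 1).choose (moduleDim R M - i) : ℤ)

theorem eq_zero_of_eventually_sum_choose (d : ℕ) : ∀ a : ℕ → ℤ,
    (∀ᶠ n : ℕ in atTop, ∑ k ∈ Finset.range (d + 1), a k * ((n + k - 1).choose k : ℤ) = 0) →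
    ∀ k ≤ d, a k = 0 := by
  induction d with
  | zero =>
    intro a h k hk
    obtain ⟨n, hn⟩ := h.exists
    obtain rfl : k = 0 := by omega
    simpa using hn
  | succ d ih =>
    intro a h
    have key : ∀ j ≤ d, a (j + 1) = 0 := by
      apply ih (fun j => a (j + 1))
      obtain ⟨N, hN⟩ := eventually_atTop.1 h
      refine eventually_atTop.2 ⟨N + 2, fun m hm => ?_⟩
      obtain ⟨n, rfl⟩ : ∃ n, m = n + 1 := ⟨m - 1, by omega⟩
      have h1 := hN (n + 1) (by omega)
      have h0 := hN n (by omega)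
      rw [Finset.sum_range_succ'] at h1 h0
      have hs : ∑ k ∈ Finset.range (d + 1), a (k + 1) * ((n + 1 + k - 1).choose k : ℤ) =
          ∑ k ∈ Finset.range (d + 1), a (k + 1) * ((n + 1 + (k + 1) - 1).choose (k + 1) : ℤ) -
          ∑ k ∈ Finset.range (d + 1), a (k + 1) * ((n + (k + 1) - 1).choose (k + 1) : ℤ) := by
        rw [← Finset.sum_sub_distrib]
        refine Finset.sum_congr rfl fun k _ => ?_
        have e1 : n + 1 + (k + 1) - 1 = (n + k) + 1 := by omega
        have e2 : n + (k + 1) - 1 = n + k := by omega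
        have e3 : n + 1 + k - 1 = n + k := by omega
        rw [e1, e2, e3, Nat.choose_succ_succ]
        push_cast
        ring
      rw [hs]
      simp only [add_zero, Nat.choose_zero_right] at h1 h0
      linarith
    intro k hk
    rcases k with _ | j
    · obtain ⟨n, hn⟩ := h.exists
      rw [Finset.sum_range_succ', Finset.sum_eq_zero] at hn
      · simpa using hn
      · intro k hk
        rw [key k (by simpa [Nat.lt_succ_iff] using hk), zero_mul]
    · exact key j (by omega)

/-- The Hilbert coefficients are uniquely determined. -/
theorem IsHilbertCoefficients.unique {R M : Type*} [CommRing R] [AddCommGroup M] [Module R M]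
    {I : Ideal R} {e e' : ℕ → ℤ} (h : IsHilbertCoefficients R M I e)
    (h' : IsHilbertCoefficients R M I e') : e = e' := by
  have key := eq_zero_of_eventually_sum_choose (moduleDim R M)
    (fun k => (-1) ^ (moduleDim R M - k) * (e (moduleDim R M - k) - e' (moduleDim R M - k))) (by
      filter_upwards [h.2, h'.2] with n hn hn'
      have := sub_eq_zero.2 (hn.2.symm.trans hn'.2)
      rw [← Finset.sum_sub_distrib, ← Finset.sum_range_reflect] at this
      rw [← this]
      refine Finset.sum_congr rfl fun k hk => ?_
      have hk' : k ≤ moduleDim R M := by simpa [Nat.lt_succ_iff] using hk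
      have e1 : moduleDim R M + 1 - 1 - k = moduleDim R M - k := by omega
      have e2 : moduleDim R M - (moduleDim R M - k) = k := by omega
      rw [e1, e2]
      ring)
  funext i
  rcases lt_or_ge (moduleDim R M) i with hi | hi
  · rw [h.1 i hi, h'.1 i hi]
  · have := key (moduleDim R M - i) (by omega)
    have e2 : moduleDim R M - (moduleDim R M - i) = i := by omega
    simp only [e2, mul_eq_zero, pow_eq_zero_iff', neg_eq_zero, one_ne_zero, false_and,
      false_or, sub_eq_zero] at this
    exact this

open Classical in
/-- The `i`-th Hilbert coefficient `e_i(I, M)`; the value is `0` if the Hilbert function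
does not have the required form. `hilbertCoeff R R I 1` is the Chern number `e_1(I)`. -/
noncomputable def hilbertCoeff (R M : Type*) [CommRing R] [AddCommGroup M] [Module R M]
    (I : Ideal R) (i : ℕ) : ℤ :=
  if h : ∃ e : ℕ → ℤ, IsHilbertCoefficients R M I e then h.choose i else 0

theorem IsHilbertCoefficients.hilbertCoeff_eq {R M : Type*} [CommRing R] [AddCommGroup M]
    [Module R M] {I : Ideal R} {e : ℕ → ℤ} (h : IsHilbertCoefficients R M I e) (i : ℕ) :
    hilbertCoeff R M I i = e i := by
  have hex : ∃ e : ℕ → ℤ, IsHilbertCoefficients R M I e := ⟨e, h⟩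
  rw [hilbertCoeff, dif_pos hex, hex.choose_spec.unique h]

end LocalHilbert

/-!
Let `R` embed into a maximal Cohen–Macaulay module `E`. The argument is an induction on the number
of generators of `J`, and it needs modules: `R` is replaced by a submodule `M` of a module `E` on
which the generators form a regular sequence. Choose `y` generically in `J`. It is part of a
generating set of `J`, it is superficial for `M`, and it is filter-regular on `E / M`, so
`N = M ∩ y E` contains `y M` with a quotient of finite length, and `M / N` embeds into `E / y E`.
Passing from `M` to `M / N` lowers the number of generators by one. It leaves `e_1` unchanged when
at least three generators are present, and for two generators
`e_1(J, M) = e_1(J, M / N) - λ(N / y M)`; for a single generator `e_1 = 0`. Hence `e_1 ≤ 0`.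

If `e_1 = 0`, then the generators are regular on `M / N` by induction, and it remains to see that
`N = y M`. For two generators this is the vanishing of `λ(N / y M)`. For three or more, `M / N` has
depth at least two, so the `J`-power torsion of `E / M` lies in `y (E / M)`; by Nakayama's lemma
a filter-regular `y` then acts injectively on `E / M`, which says that `N = y M`.

Generic choices require an infinite residue field, which is provided by `R(t)`.
-/

namespace LocalHilbert

open IsLocalRing Filter RingTheory.Sequence
open scoped Pointwise TensorProduct Polynomial

section IdealOfDefinition

variable {R : Type*} [CommRing R]

theorem le_annihilator_quotient_smul_top (M : Type*) [AddCommGroup M] [Module R M] (I : Ideal R) :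
    I ≤ Module.annihilator R (M ⧸ (I • ⊤ : Submodule R M)) := by
  rw [Submodule.annihilator_quotient]
  exact fun r hr => Submodule.mem_colon.2 fun v _ => Submodule.smul_mem_smul hr trivial

variable [IsLocalRing R] {M N : Type*} [AddCommGroup M] [Module R M] [AddCommGroup N] [Module R N]

/-- `I` is an ideal of definition for `M`: modulo the annihilator of `M` it contains a power of
the maximal ideal. The ideal `I` itself need not be contained in the maximal ideal. -/
def IsIdealOfDefinition (M : Type*) [AddCommGroup M] [Module R M] (I : Ideal R) : Prop :=
  ∃ k : ℕ, maximalIdeal R ^ k ≤ I ⊔ Module.annihilator R M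

theorem IsIdealOfDefinition.mono {I J : Ideal R} (hI : IsIdealOfDefinition M I)
    (hIJ : I ≤ J ⊔ Module.annihilator R N)
    (hann : Module.annihilator R M ≤ Module.annihilator R N) :
    IsIdealOfDefinition N J :=
  hI.imp fun _ hk => hk.trans (sup_le hIJ (le_sup_of_le_right hann))

theorem IsIdealOfDefinition.of_cons {x : R} {xs : List R}
    (h : IsIdealOfDefinition M (Ideal.ofList (x :: xs))) (hx : x ∈ Module.annihilator R N)
    (hann : Module.annihilator R M ≤ Module.annihilator R N) :
    IsIdealOfDefinition N (Ideal.ofList xs) := by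
  refine h.mono ?_ hann
  rw [Ideal.ofList_cons, sup_comm]
  exact sup_le_sup_left ((Ideal.span_singleton_le_iff_mem _).2 hx) _

theorem IsIdealOfDefinition.pow {I : Ideal R} (h : IsIdealOfDefinition M I) (n : ℕ) :
    IsIdealOfDefinition M (I ^ n) := by
  obtain ⟨k, hk⟩ := h
  refine ⟨k * (n + 1), ?_⟩
  calc maximalIdeal R ^ (k * (n + 1)) = (maximalIdeal R ^ k) ^ (n + 1) := pow_mul ..
    _ ≤ (I ⊔ Module.annihilator R M) ^ (n + 1) := Ideal.pow_right_mono hk _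
    _ ≤ I ^ n ⊔ Module.annihilator R M ^ 1 := Ideal.sup_pow_add_le_pow_sup_pow
    _ = I ^ n ⊔ Module.annihilator R M := by rw [pow_one]

theorem exists_pow_maximalIdeal_le_annihilator (h : Module.length R M ≠ ⊤) :
    ∃ k : ℕ, maximalIdeal R ^ k ≤ Module.annihilator R M := by
  rw [Module.length_ne_top_iff, isFiniteLength_iff_isNoetherian_isArtinian] at h
  obtain ⟨_, _⟩ := h
  obtain ⟨k, hk⟩ := IsArtinian.monotone_stabilizes
    (⟨fun k => OrderDual.toDual (maximalIdeal R ^ k • (⊤ : Submodule R M)), fun i j hij =>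
      Submodule.smul_mono_left (Ideal.pow_le_pow_right hij)⟩ : ℕ →o (Submodule R M)ᵒᵈ)
  have hstable : maximalIdeal R ^ k • (⊤ : Submodule R M) =
      maximalIdeal R • maximalIdeal R ^ k • ⊤ := by
    rw [← mul_smul, ← pow_succ']
    exact hk (k + 1) k.le_succ
  have hbot := Submodule.eq_bot_of_le_smul_of_le_jacobson_bot _ _
    (IsNoetherian.noetherian _) hstable.le (maximalIdeal_le_jacobson _)
  exact ⟨k, by rwa [← Submodule.annihilator_top, Submodule.le_annihilator_iff]⟩

variable [IsNoetherianRing R]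

theorem isArtinianRing_quotient_of_pow_maximalIdeal_le {I : Ideal R} (hI : I ≠ ⊤) {k : ℕ}
    (hk : maximalIdeal R ^ k ≤ I) : IsArtinianRing (R ⧸ I) := by
  have : Nontrivial (R ⧸ I) := Ideal.Quotient.nontrivial_iff.2 hI
  have : IsLocalRing (R ⧸ I) := .of_surjective' (Ideal.Quotient.mk I) Ideal.Quotient.mk_surjective
  rw [isArtinianRing_iff_isNilpotent_maximalIdeal]
  refine ⟨k, ?_⟩
  rwa [← map_maximalIdeal_of_surjective (Ideal.Quotient.mk I) Ideal.Quotient.mk_surjective,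
    ← Ideal.map_pow, Ideal.zero_eq_bot, Ideal.map_eq_bot_iff_le_ker, Ideal.mk_ker]

theorem length_ne_top_of_pow_maximalIdeal_le_annihilator [Module.Finite R M] {k : ℕ}
    (hk : maximalIdeal R ^ k ≤ Module.annihilator R M) : Module.length R M ≠ ⊤ := by
  rcases subsingleton_or_nontrivial M with _ | hM
  · simp [Module.length_eq_zero]
  have := isArtinianRing_quotient_of_pow_maximalIdeal_le
    (mt Module.annihilator_eq_top_iff.1 (not_subsingleton M)) hk
  let : Module (R ⧸ Module.annihilator R M) M := Module.quotientAnnihilator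
  have : IsScalarTower R (R ⧸ Module.annihilator R M) M :=
    (Module.isTorsionBySet_annihilator R M).isScalarTower
  have : Module.Finite (R ⧸ Module.annihilator R M) M := .of_restrictScalars_finite R _ _
  have : IsArtinian R M :=
    isArtinian_of_surjective_algebraMap (R := R ⧸ Module.annihilator R M)
      Ideal.Quotient.mk_surjective
  exact Module.length_ne_top

theorem IsIdealOfDefinition.length_ne_top [Module.Finite R N] {I : Ideal R}
    (h : IsIdealOfDefinition M I) (hI : I ≤ Module.annihilator R N)
    (hann : Module.annihilator R M ≤ Module.annihilator R N) : Module.length R N ≠ ⊤ := by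
  obtain ⟨k, hk⟩ := h
  exact length_ne_top_of_pow_maximalIdeal_le_annihilator (hk.trans (sup_le hI hann))

theorem IsIdealOfDefinition.length_quotient_ne_top [Module.Finite R M] {I : Ideal R}
    (h : IsIdealOfDefinition M I) : Module.length R (M ⧸ (I • ⊤ : Submodule R M)) ≠ ⊤ :=
  h.length_ne_top (le_annihilator_quotient_smul_top M I)
    (LinearMap.annihilator_le_of_surjective _ (Submodule.mkQ_surjective _))

theorem isIdealOfDefinition_of_length_ne_top [Module.Finite R M] {I : Ideal R}
    (h : Module.length R (M ⧸ (I • ⊤ : Submodule R M)) ≠ ⊤) : IsIdealOfDefinition M I := by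
  obtain ⟨k, hk⟩ := exists_pow_maximalIdeal_le_annihilator h
  refine Ideal.exists_pow_le_of_le_radical_of_fg ?_ (IsNoetherian.noetherian _)
  rw [Ideal.radical_eq_sInf]
  refine le_sInf fun p ⟨hle, hp⟩ => ?_
  have hsupp : (⟨p, hp⟩ : PrimeSpectrum R) ∈ Module.support R (M ⧸ (I • ⊤ : Submodule R M)) := by
    rw [Module.support_quotient]
    exact ⟨Module.mem_support_iff_of_finite.2 (le_sup_right.trans hle), le_sup_left.trans hle⟩
  exact hp.le_of_pow_le (hk.trans (Module.mem_support_iff_of_finite.1 hsupp))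

end IdealOfDefinition

section RegularElements

variable {R : Type*} [CommRing R] {M N : Type*} [AddCommGroup M] [Module R M]
  [AddCommGroup N] [Module R N]

theorem mem_smul_top_iff {y : R} {v : M} : v ∈ y • (⊤ : Submodule R M) ↔ ∃ w, y • w = v := by
  simp [Submodule.mem_smul_pointwise_iff_exists]

theorem annihilator_le_annihilator_quotSMulTop (y : R) :
    Module.annihilator R M ≤ Module.annihilator R (QuotSMulTop y M) :=
  LinearMap.annihilator_le_of_surjective _ (Submodule.mkQ_surjective _)

theorem mem_range_of_smul_mem_range {g : M →ₗ[R] N} (hg : Function.Injective g) {a b : R}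
    (ha : IsSMulRegular N a) (hb : IsSMulRegular (QuotSMulTop a M) b) {q : N}
    (haq : a • q ∈ g.range) (hbq : b • q ∈ g.range) : q ∈ g.range := by
  obtain ⟨m, hm⟩ := haq
  obtain ⟨n, hn⟩ := hbq
  have hbm : b • m = a • n := hg (by rw [map_smul, map_smul, hm, hn, smul_comm])
  obtain ⟨p, rfl⟩ : ∃ p, a • p = m := mem_smul_top_iff.1
    (mem_of_isSMulRegular_quotient_of_smul_mem hb (hbm ▸ mem_smul_top_iff.2 ⟨n, rfl⟩))
  exact ⟨p, ha (by simpa only [map_smul] using hm)⟩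

theorem mem_smul_top_of_isSMulRegular {x a b : R} (hx : IsSMulRegular M x)
    (ha : IsSMulRegular M a) (hb : IsSMulRegular (QuotSMulTop a M) b) {v : M}
    (hav : a • v ∈ x • (⊤ : Submodule R M)) (hbv : b • v ∈ x • (⊤ : Submodule R M)) :
    v ∈ x • (⊤ : Submodule R M) := by
  have hrange : x • (⊤ : Submodule R M) = (LinearMap.lsmul R M x).range := by
    ext; simp [mem_smul_top_iff]
  rw [hrange] at hav hbv ⊢
  exact mem_range_of_smul_mem_range (g := LinearMap.lsmul R M x) hx ha hb hav hbv

theorem exists_isSMulRegular_mem [IsNoetherianRing R] [Module.Finite R M] {I : Ideal R}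
    (h : ∀ v : M, (∀ r ∈ I, r • v = 0) → v = 0) : ∃ r ∈ I, IsSMulRegular M r := by
  have hzero : ∀ g : (R ⧸ I) →ₗ[R] M, g = 0 := fun g => LinearMap.ext fun u => h _ fun r hr => by
    have hru : r • u = 0 :=
      Module.mem_annihilator.1 (Ideal.annihilator_quotient.ge hr) u
    rw [← map_smul, hru, map_zero]
  simpa only [Ideal.annihilator_quotient] using
    IsSMulRegular.subsingleton_linearMap_iff.1 (subsingleton_of_forall_eq 0 hzero)

theorem exists_eq_pow_smul_notMem_smul_top [IsLocalRing R] [IsNoetherianRing R]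
    [Module.Finite R M] {y : R} (hy : y ∈ maximalIdeal R) {v : M} (hv : v ≠ 0) :
    ∃ (k : ℕ) (w : M), y ^ k • w = v ∧ w ∉ y • (⊤ : Submodule R M) := by
  by_contra! h
  have hdvd : ∀ k : ℕ, ∃ w, y ^ k • w = v := by
    intro k
    induction k with
    | zero => exact ⟨v, by rw [pow_zero, one_smul]⟩
    | succ k ih =>
      obtain ⟨w, hw⟩ := ih
      obtain ⟨u, rfl⟩ := mem_smul_top_iff.1 (h k w hw)
      exact ⟨u, by rw [pow_succ, mul_smul, hw]⟩
  have hmem : v ∈ ⨅ k, Ideal.span {y} ^ k • (⊤ : Submodule R M) := by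
    simpa only [Submodule.mem_iInf, Ideal.span_singleton_pow, Submodule.ideal_span_singleton_smul,
      mem_smul_top_iff] using hdvd
  have hspan : Ideal.span {y} ≠ ⊤ := by rwa [Ne, Ideal.span_singleton_eq_top]
  rw [Ideal.iInf_pow_smul_eq_bot_of_isLocalRing _ hspan] at hmem
  exact hv hmem

end RegularElements

section RegularSequences

variable {R : Type*} [CommRing R] [IsLocalRing R] {M : Type*} [AddCommGroup M] [Module R M]

theorem isWeaklyRegular_cons_of_mem_span_sup [IsNoetherian R M] {y z : R} {xs : List R}
    (h : IsWeaklyRegular M (y :: xs)) (hy : y ∈ maximalIdeal R) (hz : z ∈ maximalIdeal R)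
    (hxs : ∀ x ∈ xs, x ∈ maximalIdeal R) (hyz : y ∈ Ideal.span {z} ⊔ Ideal.ofList xs) :
    IsWeaklyRegular M (z :: xs) := by
  have hyxs : IsWeaklyRegular M (xs ++ [y]) :=
    isWeaklyRegular_of_perm_of_subset_maximalIdeal h (List.perm_append_singleton y xs).symm
      (List.forall_mem_cons.2 ⟨hy, hxs⟩)
  rw [isWeaklyRegular_append_iff, isWeaklyRegular_singleton_iff] at hyxs
  obtain ⟨c, t, ht, rfl⟩ := Ideal.mem_span_singleton_sup.1 hyz
  have htann := le_annihilator_quotient_smul_top M (Ideal.ofList xs) ht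
  have hreg : IsSMulRegular (M ⧸ (Ideal.ofList xs • ⊤ : Submodule R M)) z := by
    refine IsSMulRegular.of_smul (R := R) c fun u v huv => hyxs.2 ?_
    simp only [smul_eq_mul] at huv
    simp only [add_smul, huv, Module.mem_annihilator.1 htann]
  exact isWeaklyRegular_of_perm_of_subset_maximalIdeal
    ((isWeaklyRegular_append_iff M xs [z]).2 ⟨hyxs.1, (isWeaklyRegular_singleton_iff _ z).2 hreg⟩)
    (List.perm_append_singleton z xs)
    (List.forall_mem_append.2 ⟨hxs, List.forall_mem_singleton.2 hz⟩)

/-- There is a weakly `M`-regular sequence of length `n` in the maximal ideal. For a nonzero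
finitely generated `M` this says that the depth of `M` is at least `n`; it holds for every `n` if
`M` is zero. -/
def DepthGE (R : Type*) [CommRing R] [IsLocalRing R] (n : ℕ) (M : Type*) [AddCommGroup M]
    [Module R M] : Prop :=
  ∃ rs : List R, rs.length = n ∧ (∀ r ∈ rs, r ∈ maximalIdeal R) ∧ IsWeaklyRegular M rs

theorem depthGE_zero : DepthGE R 0 M :=
  ⟨[], rfl, List.forall_mem_nil _, .nil R M⟩

theorem depthGE_succ_iff {n : ℕ} : DepthGE R (n + 1) M ↔
    ∃ x ∈ maximalIdeal R, IsSMulRegular M x ∧ DepthGE R n (QuotSMulTop x M) := by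
  constructor
  · rintro ⟨_ | ⟨x, rs⟩, hlen, hmem, hreg⟩
    · cases hlen
    · rw [isWeaklyRegular_cons_iff] at hreg
      rw [List.forall_mem_cons] at hmem
      exact ⟨x, hmem.1, hreg.1, rs, Nat.succ_injective hlen, hmem.2, hreg.2⟩
  · rintro ⟨x, hx, hreg, rs, rfl, hmem, hrs⟩
    exact ⟨x :: rs, rfl, List.forall_mem_cons.2 ⟨hx, hmem⟩,
      (isWeaklyRegular_cons_iff M x rs).2 ⟨hreg, hrs⟩⟩

theorem DepthGE.swap [IsNoetherian R M] {n : ℕ} {x z : R} (hx : x ∈ maximalIdeal R)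
    (hz : z ∈ maximalIdeal R) (hreg : IsSMulRegular M x) (hzreg : IsSMulRegular (QuotSMulTop x M) z)
    (h : DepthGE R n (QuotSMulTop z (QuotSMulTop x M))) :
    IsSMulRegular M z ∧ IsSMulRegular (QuotSMulTop z M) x ∧
      DepthGE R n (QuotSMulTop x (QuotSMulTop z M)) := by
  obtain ⟨rs, hlen, hmem, hrs⟩ := h
  have hperm : IsWeaklyRegular M (z :: x :: rs) :=
    isWeaklyRegular_of_perm_of_subset_maximalIdeal (rs := x :: z :: rs)
      (by simpa only [isWeaklyRegular_cons_iff] using ⟨hreg, hzreg, hrs⟩) (.swap z x rs)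
      (List.forall_mem_cons.2 ⟨hx, List.forall_mem_cons.2 ⟨hz, hmem⟩⟩)
  simp only [isWeaklyRegular_cons_iff] at hperm
  exact ⟨hperm.1, hperm.2.1, rs, hlen, hmem, hperm.2.2⟩

variable [IsNoetherianRing R]

theorem DepthGE.exists_isSMulRegular_quotSMulTop_pair [Module.Finite R M] {n : ℕ}
    (h : DepthGE R (n + 2) M) {x y : R} (hx : IsSMulRegular M x) (hy : IsSMulRegular M y) :
    ∃ z ∈ maximalIdeal R, IsSMulRegular (QuotSMulTop x M) z ∧
      IsSMulRegular (QuotSMulTop y M) z := by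
  obtain ⟨a, ha, hareg, h⟩ := depthGE_succ_iff.1 h
  obtain ⟨b, hb, hbreg, -⟩ := depthGE_succ_iff.1 h
  have hsocle : ∀ w : R, IsSMulRegular M w → ∀ v : QuotSMulTop w M,
      (∀ r ∈ maximalIdeal R, r • v = 0) → v = 0 := by
    intro w hw v hv
    obtain ⟨v, rfl⟩ := Submodule.Quotient.mk_surjective _ v
    simp only [← Submodule.Quotient.mk_smul, Submodule.Quotient.mk_eq_zero] at hv ⊢
    exact mem_smul_top_of_isSMulRegular hw hareg hbreg (hv a ha) (hv b hb)
  obtain ⟨z, hz, hzreg⟩ := exists_isSMulRegular_mem (M := QuotSMulTop x M × QuotSMulTop y M)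
    fun v hv => Prod.ext (hsocle x hx _ fun r hr => congrArg Prod.fst (hv r hr))
      (hsocle y hy _ fun r hr => congrArg Prod.snd (hv r hr))
  exact ⟨z, hz, hzreg.of_injective (LinearMap.inl R _ _) LinearMap.inl_injective,
    hzreg.of_injective (LinearMap.inr R _ _) LinearMap.inr_injective⟩

theorem DepthGE.quotSMulTop [Module.Finite R M] {n : ℕ} {x : R} (h : DepthGE R (n + 1) M)
    (hx : x ∈ maximalIdeal R) (hreg : IsSMulRegular M x) : DepthGE R n (QuotSMulTop x M) := by
  induction n generalizing M x with
  | zero => exact depthGE_zero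
  | succ n ih =>
    obtain ⟨y, hy, hyreg, hdepth⟩ := depthGE_succ_iff.1 h
    obtain ⟨z, hz, hzx, hzy⟩ := h.exists_isSMulRegular_quotSMulTop_pair hreg hyreg
    obtain ⟨hzreg, hyz, hdepth_zy⟩ := (ih hdepth hz hzy).swap hy hz hyreg hzy
    have hxz : IsSMulRegular (QuotSMulTop z M) x := (depthGE_zero.swap hx hz hreg hzx).2.1
    have hdepth_zx := ih (depthGE_succ_iff.2 ⟨y, hy, hyz, hdepth_zy⟩) hx hxz
    exact depthGE_succ_iff.2 ⟨z, hz, hzx, (hdepth_zx.swap hz hx hzreg hxz).2.2⟩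

theorem supportDim_span_singleton_mkQ_succ_le [Module.Finite R M] {y : R} (hy : y ∈ maximalIdeal R)
    (hreg : IsSMulRegular M y) (v : M) :
    Module.supportDim R (Submodule.span R {(y • (⊤ : Submodule R M)).mkQ v}) + 1 ≤
      Module.supportDim R (Submodule.span R {v}) := by
  set P := Submodule.span R {v}
  have hmap : P.map (y • (⊤ : Submodule R M)).mkQ =
      Submodule.span R {(y • (⊤ : Submodule R M)).mkQ v} := by
    rw [Submodule.map_span, Set.image_singleton]
  let g : QuotSMulTop y P →ₗ[R] P.map (y • (⊤ : Submodule R M)).mkQ :=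
    Submodule.liftQ _ ((y • (⊤ : Submodule R M)).mkQ.submoduleMap P) (by
      rintro _ ⟨u, -, rfl⟩
      exact Subtype.ext ((Submodule.Quotient.mk_eq_zero _).2 (mem_smul_top_iff.2 ⟨u, rfl⟩)))
  have hg : Function.Surjective g := fun u =>
    (LinearMap.submoduleMap_surjective _ P u).imp' Submodule.Quotient.mk fun _ hw => hw
  rw [← hmap, ← Module.supportDim_quotSMulTop_succ_eq_supportDim (hreg.submodule P) hy]
  exact add_le_add_left (Module.supportDim_le_of_surjective g hg) 1

theorem DepthGE.le_supportDim_span_singleton [Module.Finite R M] {n : ℕ} (h : DepthGE R n M) {v : M}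
    (hv : v ≠ 0) : (n : WithBot ℕ∞) ≤ Module.supportDim R (Submodule.span R {v}) := by
  induction n generalizing M with
  | zero =>
    have : Nontrivial (Submodule.span R {v}) := Submodule.nontrivial_span_singleton hv
    have : Nonempty (Module.support R (Submodule.span R {v})) :=
      (Module.nonempty_support_of_nontrivial).to_subtype
    exact Order.krullDim_nonneg
  | succ n ih =>
    obtain ⟨y, hy, hreg, hdepth⟩ := depthGE_succ_iff.1 h
    obtain ⟨k, w, rfl, hw⟩ := exists_eq_pow_smul_notMem_smul_top hy hv
    have hmaps : ∀ u ∈ Submodule.span R {w},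
        LinearMap.lsmul R M (y ^ k) u ∈ Submodule.span R {y ^ k • w} := by
      intro u hu
      obtain ⟨c, rfl⟩ := Submodule.mem_span_singleton.1 hu
      exact Submodule.mem_span_singleton.2 ⟨c, smul_comm ..⟩
    have hinj : Function.Injective ((LinearMap.lsmul R M (y ^ k)).restrict hmaps) :=
      fun u u' huu' => Subtype.ext (hreg.pow k (congrArg Subtype.val huu'))
    calc ((n + 1 : ℕ) : WithBot ℕ∞) = n + 1 := Nat.cast_succ n
      _ ≤ Module.supportDim R (Submodule.span R {(y • (⊤ : Submodule R M)).mkQ w}) + 1 :=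
        add_le_add_left (ih hdepth (mt (Submodule.Quotient.mk_eq_zero _).1 hw)) 1
      _ ≤ Module.supportDim R (Submodule.span R {w}) :=
        supportDim_span_singleton_mkQ_succ_le hy hreg w
      _ ≤ Module.supportDim R (Submodule.span R {y ^ k • w}) :=
        Module.supportDim_le_of_injective _ hinj

theorem DepthGE.le_supportDim [Module.Finite R M] {n : ℕ} (h : DepthGE R n M) {N : Type*}
    [AddCommGroup N] [Module R N] [Nontrivial N] {g : N →ₗ[R] M} (hg : Function.Injective g) :
    (n : WithBot ℕ∞) ≤ Module.supportDim R N := by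
  obtain ⟨v, hv⟩ := exists_ne (0 : N)
  have hle : Submodule.span R {g v} ≤ g.range :=
    (Submodule.span_singleton_le_iff_mem _ _).2 ⟨v, rfl⟩
  calc (n : WithBot ℕ∞) ≤ Module.supportDim R (Submodule.span R {g v}) :=
        h.le_supportDim_span_singleton ((map_ne_zero_iff g hg).2 hv)
    _ ≤ Module.supportDim R g.range :=
        Module.supportDim_le_of_injective _ (Submodule.inclusion_injective hle)
    _ = Module.supportDim R N :=
        (Module.supportDim_eq_of_equiv (LinearEquiv.ofInjective g hg)).symm

theorem supportDim_le_length [Module.Finite R M] {xs : List R}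
    (hxs : ∀ x ∈ xs, x ∈ maximalIdeal R) (h : IsIdealOfDefinition M (Ideal.ofList xs)) :
    Module.supportDim R M ≤ xs.length := by
  induction xs generalizing M with
  | nil =>
    obtain ⟨k, hk⟩ := h
    rw [Ideal.ofList_nil, bot_sup_eq] at hk
    have hmax (p : Module.support R M) : p.1.asIdeal = maximalIdeal R :=
      le_antisymm (le_maximalIdeal p.1.2.ne_top)
        (p.1.2.le_of_pow_le (hk.trans (Module.mem_support_iff_of_finite.1 p.2)))
    have : Subsingleton (Module.support R M) :=
      ⟨fun p q => Subtype.ext (PrimeSpectrum.ext ((hmax p).trans (hmax q).symm))⟩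
    exact Order.krullDim_nonpos_of_subsingleton
  | cons x xs ih =>
    rw [List.forall_mem_cons] at hxs
    calc Module.supportDim R M ≤ Module.supportDim R (QuotSMulTop x M) + 1 :=
          Module.supportDim_le_supportDim_quotSMulTop_succ hxs.1
      _ ≤ xs.length + 1 := add_le_add_left (ih hxs.2 (h.of_cons (QuotSMulTop.mem_annihilator M x)
          (annihilator_le_annihilator_quotSMulTop x))) 1
      _ = (x :: xs).length := by rw [List.length_cons, Nat.cast_succ]

theorem DepthGE.isWeaklyRegular [Module.Finite R M] {xs : List R} (h : DepthGE R xs.length M)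
    (hxs : ∀ x ∈ xs, x ∈ maximalIdeal R) (hI : IsIdealOfDefinition M (Ideal.ofList xs)) :
    IsWeaklyRegular M xs := by
  induction xs generalizing M with
  | nil => exact .nil R M
  | cons x xs ih =>
    rw [List.forall_mem_cons] at hxs
    have hreg : IsSMulRegular M x := by
      rw [isSMulRegular_iff_ker_lsmul_eq_bot]
      by_contra hker
      set K := LinearMap.ker (LinearMap.lsmul R M x)
      have : Nontrivial K := Submodule.nontrivial_iff_ne_bot.2 hker
      have hx : x ∈ Module.annihilator R K := Module.mem_annihilator.2 fun v => Subtype.ext v.2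
      have hdim : Module.supportDim R K ≤ xs.length := supportDim_le_length hxs.2
        (hI.of_cons hx (LinearMap.annihilator_le_of_injective K.subtype K.injective_subtype))
      have hlt : (x :: xs).length ≤ xs.length := by
        exact_mod_cast (h.le_supportDim K.injective_subtype).trans hdim
      exact absurd hlt (Nat.not_succ_le_self _)
    exact (isWeaklyRegular_cons_iff M x xs).2 ⟨hreg, ih (h.quotSMulTop hxs.1 hreg) hxs.2
      (hI.of_cons (QuotSMulTop.mem_annihilator M x) (annihilator_le_annihilator_quotSMulTop x))⟩

end RegularSequences

section Generic

variable {R : Type*} [CommRing R]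

/-- The filter on a module generated by the complements of the proper submodules: a property of
elements of `F` holds eventually along it if it holds outside finitely many proper submodules. It
expresses that a property holds for a general element of `F`. -/
def genericFilter (R F : Type*) [CommRing R] [AddCommGroup F] [Module R F] : Filter F :=
  .generate {s | ∃ P : Submodule R F, P ≠ ⊤ ∧ s = (P : Set F)ᶜ}

theorem eventually_notMem_genericFilter {F : Type*} [AddCommGroup F] [Module R F]
    {P : Submodule R F} (hP : P ≠ ⊤) : ∀ᶠ a in genericFilter R F, a ∉ P :=
  mem_generate_of_mem ⟨P, hP, rfl⟩

theorem finite_residueField_of_finiteIndex [IsLocalRing R] {F : Type*} [AddCommGroup F] [Module R F]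
    [Module.Finite R F] {P : Submodule R F} (hP : P ≠ ⊤) (hidx : P.toAddSubgroup.FiniteIndex) :
    Finite (ResidueField R) := by
  obtain ⟨Q, hQ, hPQ⟩ := (eq_top_or_exists_le_coatom P).resolve_left hP
  have : Finite (F ⧸ P) := AddSubgroup.finite_quotient_of_finiteIndex (H := P.toAddSubgroup)
  have : Finite (F ⧸ Q) :=
    Finite.of_surjective (Submodule.factor hPQ) (Submodule.factor_surjective hPQ)
  obtain ⟨m, hm, ⟨e⟩⟩ := isSimpleModule_iff_quot_maximal.1 (isSimpleModule_iff_isCoatom.2 hQ)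
  obtain rfl := eq_maximalIdeal hm
  exact Finite.of_equiv _ e.toEquiv

theorem genericFilter_neBot [IsLocalRing R] [Infinite (ResidueField R)] (F : Type*)
    [AddCommGroup F] [Module R F] [Module.Finite R F] : (genericFilter R F).NeBot := by
  rw [genericFilter, generate_neBot_iff]
  intro t ht hfin
  have hcompl : ∀ s ∈ t, ∃ P : Submodule R F, P ≠ ⊤ ∧ s = (P : Set F)ᶜ := fun s hs => ht hs
  choose! P hP hs using hcompl
  by_contra hempty
  have hcover : ⋃ s ∈ hfin.toFinset, (P s : Set F) = Set.univ := by
    refine Set.eq_univ_of_forall fun a => ?_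
    have ha : a ∉ ⋂₀ t := fun ha => hempty ⟨a, ha⟩
    simp only [Set.mem_sInter, not_forall] at ha
    obtain ⟨s, hst, has⟩ := ha
    exact Set.mem_biUnion (hfin.mem_toFinset.2 hst) (Set.notMem_compl_iff.1 (hs s hst ▸ has))
  obtain ⟨s, hs, hidx⟩ := Submodule.exists_finiteIndex_of_cover hcover
  have := finite_residueField_of_finiteIndex (hP s (hfin.mem_toFinset.1 hs)) hidx
  exact not_finite (ResidueField R)

theorem eventually_span_singleton_sup_eq [IsLocalRing R] [IsNoetherianRing R] {x : R}
    {I J : Ideal R} (hI : Ideal.span {x} ⊔ J = I) :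
    ∀ᶠ y : I in genericFilter R I, Ideal.span {(y : R)} ⊔ J = I := by
  have hJI : J ≤ I := hI ▸ le_sup_right
  by_cases hP : Submodule.comap I.subtype (J ⊔ maximalIdeal R • I) = ⊤
  · rw [Submodule.comap_subtype_eq_top] at hP
    have hle : I ≤ J := Submodule.le_of_le_smul_of_le_jacobson_bot (IsNoetherian.noetherian I)
      (maximalIdeal_le_jacobson _) hP
    exact .of_forall fun y => le_antisymm
      (sup_le ((Ideal.span_singleton_le_iff_mem _).2 y.2) hJI) (le_sup_of_le_right hle)
  · filter_upwards [eventually_notMem_genericFilter hP] with y hy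
    refine le_antisymm (sup_le ((Ideal.span_singleton_le_iff_mem _).2 y.2) hJI) ?_
    obtain ⟨c, t, ht, hct⟩ := Ideal.mem_span_singleton_sup.1 (hI.ge y.2)
    have hx : x ∈ I := hI.le (Ideal.mem_sup_left (Ideal.mem_span_singleton_self x))
    have hc : IsUnit c := by
      by_contra hc
      refine hy ?_
      rw [Submodule.mem_comap, Submodule.subtype_apply, ← hct, add_comm]
      exact Submodule.add_mem_sup ht (Submodule.smul_mem_smul ((mem_maximalIdeal c).2 hc) hx)
    refine hI.ge.trans (sup_le ((Ideal.span_singleton_le_iff_mem _).2 ?_) le_sup_right)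
    rw [← Ideal.unit_mul_mem_iff_mem _ hc, eq_sub_of_add_eq hct]
    exact sub_mem (Ideal.mem_sup_left (Ideal.mem_span_singleton_self _)) (Ideal.mem_sup_right ht)

end Generic

section FilterRegular

/-- The element `y` is `I`-filter-regular on `M`: its annihilator in `M` is killed by a power
of `I`. -/
def IsFilterRegular {R : Type*} [CommRing R] (I : Ideal R) (M : Type*) [AddCommGroup M] [Module R M]
    (y : R) : Prop :=
  ∃ c : ℕ, ∀ v : M, y • v = 0 → ∀ b ∈ I ^ c, b • v = 0

variable {R B F M : Type*} [CommRing R] [CommRing B] [IsNoetherianRing B] [AddCommGroup F]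
  [Module R F] [AddCommGroup M] [Module B M] [Module.Finite B M]

theorem eventually_isFilterRegular [Algebra R B] (g : F →ₗ[R] B) :
    ∀ᶠ a in genericFilter R F, IsFilterRegular (Ideal.span (Set.range g)) M (g a) := by
  set A := Ideal.span (Set.range g)
  have havoid : ∀ᶠ a in genericFilter R F, ∀ P ∈ associatedPrimes B M, ¬ A ≤ P → g a ∉ P := by
    refine (eventually_all_finite (associatedPrimes.finite B M)).2 fun P _ => ?_
    by_cases hAP : A ≤ P
    · exact .of_forall fun a h => absurd hAP h
    · have htop : (P.restrictScalars R).comap g ≠ ⊤ := by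
        refine fun h => hAP (Ideal.span_le.2 ?_)
        rintro _ ⟨a, rfl⟩
        exact (h.ge trivial : a ∈ (P.restrictScalars R).comap g)
      exact (eventually_notMem_genericFilter htop).mono fun a ha _ => ha
  filter_upwards [havoid] with a ha
  let K : Submodule B M := LinearMap.ker (LinearMap.lsmul B M (g a))
  have hrad : A ≤ (Module.annihilator B K).radical := by
    rw [← Ideal.sInf_minimalPrimes]
    refine le_sInf fun P hP => ?_
    have hass : P ∈ associatedPrimes B M := IsAssociatedPrime.map_of_injective K.subtype
      (Module.associatedPrimes.minimalPrimes_annihilator_subset_associatedPrimes B K hP)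
      K.injective_subtype
    by_contra hAP
    exact ha P hass hAP (hP.1.2 (Module.mem_annihilator.2 fun v => Subtype.ext v.2))
  obtain ⟨c, hc⟩ := Ideal.exists_pow_le_of_le_radical_of_fg hrad (IsNoetherian.noetherian _)
  exact ⟨c, fun v hv b hb =>
    congrArg Subtype.val (Module.mem_annihilator.1 (hc hb) (⟨v, hv⟩ : K))⟩

theorem IsFilterRegular.eventually_eq_zero {I : Ideal B} {y : B} (h : IsFilterRegular I M y) :
    ∀ᶠ n in atTop, ∀ v ∈ I ^ n • (⊤ : Submodule B M), y • v = 0 → v = 0 := by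
  obtain ⟨c, hc⟩ := h
  let K : Submodule B M := LinearMap.ker (LinearMap.lsmul B M y)
  obtain ⟨k, hk⟩ := Ideal.exists_pow_inf_eq_pow_smul I K
  filter_upwards [eventually_ge_atTop (c + k)] with n hn v hv hyv
  have hzero : I ^ (n - k) • (I ^ k • ⊤ ⊓ K) ≤ ⊥ := Submodule.smul_le.2 fun b hb w hw =>
    hc w hw.2 b (Ideal.pow_le_pow_right (by lia) hb)
  rw [← hk n (by lia)] at hzero
  exact hzero ⟨hv, hyv⟩

end FilterRegular

section Superficial

variable {R M : Type*} [CommRing R] [AddCommGroup M] [Module R M]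

/-- The element `y` is superficial for `I` on `M`: multiplication by its class in `I / I ^ 2` is
injective on the associated graded module of `M` in all large degrees. -/
def IsSuperficial (I : Ideal R) (M : Type*) [AddCommGroup M] [Module R M] (y : R) : Prop :=
  ∃ c : ℕ, ∀ n ≥ c, ∀ z ∈ I ^ n • (⊤ : Submodule R M),
    y • z ∈ I ^ (n + 2) • (⊤ : Submodule R M) → z ∈ I ^ (n + 1) • (⊤ : Submodule R M)

/-- The filtration `I ^ (n + k) M`. -/
def shiftedFiltration (M : Type*) [AddCommGroup M] [Module R M] (I : Ideal R) (k : ℕ) :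
    I.Filtration M where
  N n := I ^ (n + k) • ⊤
  mono n := Submodule.smul_mono_left (Ideal.pow_le_pow_right (by lia))
  smul_le n := by
    rw [← mul_smul, ← pow_succ']
    exact Submodule.smul_mono_left (Ideal.pow_le_pow_right (by lia))

theorem shiftedFiltration_stable (I : Ideal R) (k : ℕ) : (shiftedFiltration M I k).Stable :=
  ⟨0, fun n _ => by
    change I • I ^ (n + k) • (⊤ : Submodule R M) = I ^ (n + 1 + k) • ⊤
    rw [← mul_smul, ← pow_succ', add_right_comm]⟩

theorem smul_mem_pow_succ_smul {I : Ideal R} {N : Submodule R M} {n : ℕ} {r : R} {v : M}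
    (hr : r ∈ I) (hv : v ∈ I ^ n • N) : r • v ∈ I ^ (n + 1) • N := by
  rw [pow_succ', mul_smul]
  exact Submodule.smul_mem_smul hr hv

/-- The inclusion of `I` into its Rees algebra as the homogeneous component of degree `1`. -/
noncomputable def reesDegreeOne (I : Ideal R) : I →ₗ[R] reesAlgebra I :=
  ((Polynomial.monomial 1).comp I.subtype).codRestrict (Subalgebra.toSubmodule (reesAlgebra I))
    fun a => reesAlgebra.monomial_mem.2 ((pow_one I).ge a.2)

theorem reesDegreeOne_smul_single {I : Ideal R} (a : I) (n : ℕ) (z : M) :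
    reesDegreeOne I a • PolynomialModule.single R n z =
      PolynomialModule.single R (n + 1) ((a : R) • z) := by
  rw [add_comm n 1]
  exact PolynomialModule.monomial_smul_single 1 (a : R) n z

theorem single_mem_submodule_iff {I : Ideal R} {F : I.Filtration M} {n : ℕ} {z : M} :
    PolynomialModule.single R n z ∈ F.submodule ↔ z ∈ F.N n := by
  constructor
  · intro h
    simpa using h n
  · intro hz i
    rcases eq_or_ne i n with rfl | hi
    · simpa using hz
    · simp [hi.symm]

theorem single_mem_pow_span_range_smul_submodule {I : Ideal R} (n : ℕ) {z : M}
    (hz : z ∈ I ^ n • (⊤ : Submodule R M)) : PolynomialModule.single R n z ∈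
      Ideal.span (Set.range (reesDegreeOne I)) ^ n • (shiftedFiltration M I 0).submodule := by
  induction n generalizing z with
  | zero =>
    rw [pow_zero, Ideal.one_eq_top, Submodule.top_smul, single_mem_submodule_iff]
    exact hz
  | succ n ih =>
    rw [pow_succ', mul_smul] at hz
    refine Submodule.smul_induction_on hz (fun a ha w hw => ?_) fun u v hu hv => ?_
    · rw [← reesDegreeOne_smul_single ⟨a, ha⟩]
      exact smul_mem_pow_succ_smul (Ideal.subset_span (Set.mem_range_self _)) (ih hw)
    · rw [PolynomialModule.single_add]
      exact add_mem hu hv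

variable [IsNoetherianRing R] [Module.Finite R M]

theorem eventually_isSuperficial (I : Ideal R) :
    ∀ᶠ y : I in genericFilter R I, IsSuperficial I M (y : R) := by
  let F := (shiftedFiltration M I 0).submodule
  let F' := (shiftedFiltration M I 1).submodule
  have hF : F.FG := ((shiftedFiltration M I 0).submodule_fg_iff_stable
    fun i => IsNoetherian.noetherian _).2 (shiftedFiltration_stable I 0)
  have : Module.Finite (reesAlgebra I) (F.map F'.mkQ) := Module.Finite.iff_fg.2 (hF.map _)
  filter_upwards [eventually_isFilterRegular (M := F.map F'.mkQ) (reesDegreeOne I)] with y hy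
  obtain ⟨c, hc⟩ := eventually_atTop.1 hy.eventually_eq_zero
  refine ⟨c, fun n hn z hz hyz => ?_⟩
  have hmem : F'.mkQ (PolynomialModule.single R n z) ∈
      Ideal.span (Set.range (reesDegreeOne I)) ^ n • F.map F'.mkQ := by
    rw [← Submodule.map_smul'']
    exact Submodule.mem_map_of_mem (single_mem_pow_span_range_smul_submodule n hz)
  have hzero : reesDegreeOne I y • F'.mkQ (PolynomialModule.single R n z) = 0 := by
    rw [← map_smul, reesDegreeOne_smul_single, Submodule.mkQ_apply, Submodule.Quotient.mk_eq_zero,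
      single_mem_submodule_iff]
    exact hyz
  have hclass := hc n hn ⟨_, Submodule.smul_le_right hmem⟩
    ((Submodule.mem_smul_top_iff _ _ _).2 hmem) (Subtype.ext hzero)
  exact single_mem_submodule_iff.1
    ((Submodule.Quotient.mk_eq_zero _).1 (congrArg Subtype.val hclass))

theorem IsSuperficial.eventually_mem_of_smul_mem {I : Ideal R} {y : R} (h : IsSuperficial I M y)
    (hy : IsSMulRegular M y) : ∀ᶠ n in atTop, ∀ z : M,
      y • z ∈ I ^ (n + 1) • (⊤ : Submodule R M) → z ∈ I ^ n • (⊤ : Submodule R M) := by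
  obtain ⟨c, hc⟩ := h
  obtain ⟨k, hk⟩ := Ideal.exists_pow_inf_eq_pow_smul I (y • (⊤ : Submodule R M))
  filter_upwards [eventually_ge_atTop (c + k)] with n hn z hz
  have hinf : I ^ (n + 1) • ⊤ ⊓ y • (⊤ : Submodule R M) ≤ y • I ^ (n - k) • ⊤ :=
    calc I ^ (n + 1) • ⊤ ⊓ y • (⊤ : Submodule R M)
        = I ^ (n + 1 - k) • (I ^ k • ⊤ ⊓ y • (⊤ : Submodule R M)) := hk _ (by lia)
      _ ≤ I ^ (n - k) • y • (⊤ : Submodule R M) :=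
        Submodule.smul_mono (Ideal.pow_le_pow_right (by lia)) inf_le_right
      _ = y • I ^ (n - k) • ⊤ := (Submodule.map_smul'' _ _ _).symm
  have hbase : z ∈ I ^ (n - k) • (⊤ : Submodule R M) := by
    obtain ⟨w, hw, hwz⟩ := (Submodule.mem_smul_pointwise_iff_exists _ _ _).1
      (hinf ⟨hz, mem_smul_top_iff.2 ⟨z, rfl⟩⟩)
    rwa [← hy hwz]
  have hstep (m : ℕ) (hm : n - k ≤ m) : m ≤ n → z ∈ I ^ m • (⊤ : Submodule R M) := by
    induction m, hm using Nat.le_induction with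
    | base => exact fun _ => hbase
    | succ m hm ih =>
      intro hmn
      exact hc m (by lia) z (ih (by lia))
        (Submodule.smul_mono_left (Ideal.pow_le_pow_right (by lia)) hz)
  exact hstep n (Nat.sub_le n k) le_rfl

end Superficial

section HilbertFunction

variable {R : Type*} [CommRing R] {M P : Type*} [AddCommGroup M] [Module R M] [AddCommGroup P]
  [Module R P]

theorem length_quotient_eq_add_of_comap_eq {g : P →ₗ[R] M} {A : Submodule R P} {B : Submodule R M}
    (h : B.comap g = A) :
    Module.length R (M ⧸ B) = Module.length R (P ⧸ A) + Module.length R (M ⧸ (B ⊔ g.range)) := by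
  have hker : (B.mkQ ∘ₗ g).ker = A := by rw [LinearMap.ker_comp, Submodule.ker_mkQ, h]
  have hinj : Function.Injective (A.mapQ B g h.ge) := by
    rw [← LinearMap.ker_eq_bot, Submodule.mapQ, Submodule.ker_liftQ, hker, Submodule.mkQ_map_self]
  have hexact : Function.Exact (A.mapQ B g h.ge)
      (Submodule.factor (le_sup_left : B ≤ B ⊔ g.range)) := by
    rw [LinearMap.exact_iff, Submodule.factor, Submodule.ker_mapQ, Submodule.range_mapQ]
    simp
  exact Module.length_eq_add_of_exact _ _ hinj (Submodule.factor_surjective _) hexact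

theorem length_quotient_sup_eq_add {B S T : Submodule R M} (hTS : T ≤ S) (h : S ⊓ (B ⊔ T) ≤ T) :
    Module.length R (M ⧸ (B ⊔ T)) =
      Module.length R (S ⧸ T.comap S.subtype) + Module.length R (M ⧸ (B ⊔ S)) := by
  have hcomap : (B ⊔ T).comap S.subtype = T.comap S.subtype :=
    le_antisymm (fun v hv => h ⟨v.2, hv⟩) (Submodule.comap_mono le_sup_right)
  rw [length_quotient_eq_add_of_comap_eq hcomap, Submodule.range_subtype, sup_assoc,
    sup_eq_right.2 hTS]

theorem length_quotient_quotient_smul_top (I : Ideal R) (N : Submodule R M) :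
    Module.length R ((M ⧸ N) ⧸ (I • ⊤ : Submodule R (M ⧸ N))) =
      Module.length R (M ⧸ (I • ⊤ ⊔ N : Submodule R M)) := by
  have hmap : (I • ⊤ : Submodule R (M ⧸ N)) = (I • ⊤ : Submodule R M).map N.mkQ := by
    rw [Submodule.map_smul'', Submodule.map_top, Submodule.range_mkQ]
  rw [hmap, sup_comm]
  exact (Submodule.quotientQuotientEquivQuotientSup N _).length_eq

theorem pow_smul_top_eq_of_le_sup_annihilator {I J : Ideal R} (hJI : J ≤ I)
    (hIJ : I ≤ J ⊔ Module.annihilator R M) (n : ℕ) :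
    (I ^ n • ⊤ : Submodule R M) = J ^ n • ⊤ := by
  refine le_antisymm ?_ (Submodule.smul_mono_left (Ideal.pow_right_mono hJI n))
  induction n with
  | zero => simp
  | succ n ih =>
    have hann : Module.annihilator R M • J ^ n • (⊤ : Submodule R M) = ⊥ := by
      refine eq_bot_iff.2 (Submodule.smul_le.2 fun r hr v _ => ?_)
      exact Module.mem_annihilator.1 hr v
    calc (I ^ (n + 1) • ⊤ : Submodule R M) = I • I ^ n • ⊤ := by rw [pow_succ', mul_smul]
      _ ≤ (J ⊔ Module.annihilator R M) • J ^ n • ⊤ := Submodule.smul_mono hIJ ih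
      _ = J ^ (n + 1) • ⊤ := by rw [Submodule.sup_smul, hann, sup_bot_eq, pow_succ', mul_smul]

/-- The Hilbert function `n ↦ λ(M / I ^ n M)` as an integer; infinite lengths get the value `0`. -/
noncomputable def hilbertFunction (M : Type*) [AddCommGroup M] [Module R M] (I : Ideal R)
    (n : ℕ) : ℤ :=
  (Module.length R (M ⧸ (I ^ n • ⊤ : Submodule R M))).toNat

theorem hilbertFunction_eq_of_le_sup_annihilator {I J : Ideal R} (hJI : J ≤ I)
    (hIJ : I ≤ J ⊔ Module.annihilator R M) : hilbertFunction M I = hilbertFunction M J := by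
  funext n
  rw [hilbertFunction, hilbertFunction, pow_smul_top_eq_of_le_sup_annihilator hJI hIJ]

theorem eventually_length_quotient_pow_succ [IsNoetherianRing R] [Module.Finite R M] {I : Ideal R}
    {y : R} (hyI : y ∈ I) (hreg : IsSMulRegular M y) (hsup : IsSuperficial I M y)
    {N : Submodule R M} (hyN : y • ⊤ ≤ N) {c : ℕ} (hc : I ^ c • N ≤ y • (⊤ : Submodule R M)) :
    ∀ᶠ n in atTop, Module.length R (M ⧸ (I ^ (n + 1) • ⊤ : Submodule R M)) =
      Module.length R (M ⧸ (I ^ n • ⊤ : Submodule R M)) +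
      (Module.length R (N ⧸ (y • (⊤ : Submodule R M)).comap N.subtype) +
        Module.length R ((M ⧸ N) ⧸ (I ^ (n + 1) • ⊤ : Submodule R (M ⧸ N)))) := by
  obtain ⟨k, hk⟩ := Ideal.exists_pow_inf_eq_pow_smul I N
  filter_upwards [hsup.eventually_mem_of_smul_mem hreg, eventually_ge_atTop (k + c)] with n hn hkn
  have hrange : (LinearMap.lsmul R M y).range = y • (⊤ : Submodule R M) :=
    LinearMap.range_eq_map _
  have hcolon : (I ^ (n + 1) • ⊤ : Submodule R M).comap (LinearMap.lsmul R M y) = I ^ n • ⊤ :=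
    le_antisymm hn fun z hz => smul_mem_pow_succ_smul hyI hz
  have hartinRees : I ^ (n + 1) • ⊤ ⊓ N ≤ y • (⊤ : Submodule R M) := by
    rw [hk _ (by lia)]
    exact (Submodule.smul_mono (Ideal.pow_le_pow_right (by lia)) inf_le_right).trans hc
  have hmod : N ⊓ (I ^ (n + 1) • ⊤ ⊔ y • (⊤ : Submodule R M)) ≤ y • ⊤ := by
    rw [inf_comm, sup_comm, sup_inf_assoc_of_le _ hyN]
    exact sup_le le_rfl hartinRees
  rw [length_quotient_eq_add_of_comap_eq hcolon, hrange, length_quotient_sup_eq_add hyN hmod,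
    length_quotient_quotient_smul_top]

end HilbertFunction

section HilbertSum

/-- The value at `n` of the Hilbert polynomial of degree `d` with Hilbert coefficients
`e 0, …, e d`. -/
def hilbertSum (d : ℕ) (e : ℕ → ℤ) (n : ℕ) : ℤ :=
  ∑ i ∈ Finset.range (d + 1), (-1) ^ i * e i * ((n + (d - i) - 1).choose (d - i) : ℤ)

theorem hilbertSum_congr {d : ℕ} {e e' : ℕ → ℤ} (h : ∀ i ≤ d, e i = e' i) (n : ℕ) :
    hilbertSum d e n = hilbertSum d e' n :=
  Finset.sum_congr rfl fun i hi => by rw [h i (Finset.mem_range_succ_iff.1 hi)]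

theorem hilbertSum_update (d : ℕ) (e : ℕ → ℤ) (a : ℤ) (n : ℕ) :
    hilbertSum d (Function.update e d a) n = hilbertSum d e n + (-1) ^ d * (a - e d) := by
  have hlower : ∀ i ∈ Finset.range d, Function.update e d a i = e i :=
    fun i hi => Function.update_of_ne (Finset.mem_range.1 hi).ne _ _
  rw [hilbertSum, hilbertSum, Finset.sum_range_succ, Finset.sum_range_succ,
    Finset.sum_congr rfl fun i hi => by rw [hlower i hi], Function.update_self, Nat.sub_self,
    Nat.choose_zero_right]
  ring

theorem hilbertSum_succ_sub (d : ℕ) (e : ℕ → ℤ) (n : ℕ) :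
    hilbertSum (d + 1) e (n + 1) - hilbertSum (d + 1) e n = hilbertSum d e (n + 1) := by
  have hpascal (j : ℕ) : ((n + 1 + (j + 1) - 1).choose (j + 1) : ℤ) =
      (n + 1 + j - 1).choose j + (n + (j + 1) - 1).choose (j + 1) := by
    have hj : n + 1 + (j + 1) - 1 = n + j + 1 := by lia
    have hj' : n + 1 + j - 1 = n + j := by lia
    rw [hj, hj', Nat.choose_succ_succ, Nat.cast_add, ← Nat.add_assoc, Nat.add_sub_cancel]
  rw [hilbertSum, hilbertSum, hilbertSum, Finset.sum_range_succ, Finset.sum_range_succ (n := d + 1),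
    Nat.sub_self, Nat.choose_zero_right, Nat.choose_zero_right, add_sub_add_right_eq_sub,
    ← Finset.sum_sub_distrib]
  refine Finset.sum_congr rfl fun i hi => ?_
  rw [Nat.sub_add_comm (Finset.mem_range_succ_iff.1 hi), hpascal]
  ring

theorem exists_eventually_eq_add_const {h g : ℕ → ℤ}
    (hhg : ∀ᶠ n in atTop, h (n + 1) - h n = g (n + 1) - g n) :
    ∃ c : ℤ, ∀ᶠ n in atTop, h n = g n + c := by
  obtain ⟨n₀, hn₀⟩ := eventually_atTop.1 hhg
  refine ⟨h n₀ - g n₀, eventually_atTop.2 ⟨n₀, fun n hn => ?_⟩⟩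
  induction n, hn using Nat.le_induction with
  | base => ring
  | succ n hn ih => linarith [hn₀ n hn]

theorem exists_eventuallyEq_hilbertSum_succ {h h' : ℕ → ℤ} {d : ℕ} {e' : ℕ → ℤ} {l : ℤ}
    (hh' : h' =ᶠ[atTop] hilbertSum d e')
    (hd : ∀ᶠ n in atTop, h (n + 1) = h n + (l + h' (n + 1))) :
    ∃ e : ℕ → ℤ, h =ᶠ[atTop] hilbertSum (d + 1) e ∧ (∀ i < d, e i = e' i) ∧
      e d = e' d + (-1) ^ d * l := by
  have hsign (k : ℕ) : ((-1 : ℤ) ^ k) * (-1) ^ k = 1 := by rw [← mul_pow]; simp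
  set ε := Function.update e' d (e' d + (-1) ^ d * l) with hε
  have hdiff : ∀ᶠ n in atTop,
      h (n + 1) - h n = hilbertSum (d + 1) ε (n + 1) - hilbertSum (d + 1) ε n := by
    filter_upwards [hd, (tendsto_add_atTop_nat 1).eventually hh'] with n hn hn'
    rw [hilbertSum_succ_sub, hε, hilbertSum_update, hn, hn']
    linear_combination -l * hsign d
  obtain ⟨c, hc⟩ := exists_eventually_eq_add_const hdiff
  refine ⟨Function.update ε (d + 1) (ε (d + 1) + (-1) ^ (d + 1) * c), ?_, fun i hi => ?_, ?_⟩
  · filter_upwards [hc] with n hn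
    rw [hn, hilbertSum_update]
    linear_combination -c * hsign (d + 1)
  · rw [Function.update_of_ne (by lia), hε, Function.update_of_ne hi.ne]
  · rw [Function.update_of_ne (by lia), hε, Function.update_self]

theorem hilbertCoeff_eq_of_eventuallyEq {R M : Type*} [CommRing R] [IsLocalRing R]
    [IsNoetherianRing R] [AddCommGroup M] [Module R M] [Module.Finite R M] {I : Ideal R}
    (hI : IsIdealOfDefinition M I) {e : ℕ → ℤ}
    (h : hilbertFunction M I =ᶠ[atTop] hilbertSum (moduleDim R M) e) {i : ℕ}
    (hi : i ≤ moduleDim R M) : hilbertCoeff R M I i = e i := by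
  have htrunc : ∀ j ≤ moduleDim R M, e j = if j ≤ moduleDim R M then e j else 0 :=
    fun j hj => (if_pos hj).symm
  have he : IsHilbertCoefficients R M I fun j => if j ≤ moduleDim R M then e j else 0 := by
    refine ⟨fun j hj => if_neg hj.not_ge,
      h.mono fun n hn => ⟨(hI.pow n).length_quotient_ne_top, ?_⟩⟩
    exact hn.trans (hilbertSum_congr htrunc n)
  rw [he.hilbertCoeff_eq, if_pos hi]

end HilbertSum

section PowerTorsion

variable {R : Type*} [CommRing R] {M N : Type*} [AddCommGroup M] [Module R M] [AddCommGroup N]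
  [Module R N] {I : Ideal R}

/-- The submodule of elements killed by a power of `I`, the zeroth local cohomology of `M`. -/
def powerTorsion (I : Ideal R) (M : Type*) [AddCommGroup M] [Module R M] : Submodule R M :=
  ⨆ n : ℕ, Submodule.torsionBySet R M (I ^ n : Ideal R)

theorem mem_powerTorsion_iff {v : M} :
    v ∈ powerTorsion I M ↔ ∃ n : ℕ, ∀ r ∈ I ^ n, r • v = 0 := by
  have hmono : Monotone fun n : ℕ => Submodule.torsionBySet R M (I ^ n : Ideal R) :=
    fun _ _ h => Submodule.torsionBySet_le_torsionBySet_of_subset (Ideal.pow_le_pow_right h)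
  simp [powerTorsion, Submodule.mem_iSup_of_directed _ hmono.directed_le,
    Submodule.mem_torsionBySet_iff]

theorem IsFilterRegular.mem_powerTorsion_of_smul_mem {y : R} {v : M} (hy : IsFilterRegular I M y)
    (hv : y • v ∈ powerTorsion I M) : v ∈ powerTorsion I M := by
  obtain ⟨c, hc⟩ := hy
  obtain ⟨n, hn⟩ := mem_powerTorsion_iff.1 hv
  have hle : I ^ (c + n) ≤ (Submodule.span R {v}).annihilator := by
    rw [pow_add, Ideal.mul_le]
    intro b hb r hr
    rw [Submodule.mem_annihilator_span_singleton, mul_smul]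
    exact hc _ (by rw [smul_comm, hn r hr]) b hb
  exact mem_powerTorsion_iff.2 ⟨c + n, fun r hr =>
    (Submodule.mem_annihilator_span_singleton _ _).1 (hle hr)⟩

theorem IsFilterRegular.isSMulRegular [IsLocalRing R] [IsNoetherian R M] {y : R}
    (hy : IsFilterRegular I M y) (hym : y ∈ maximalIdeal R)
    (h : powerTorsion I M ≤ y • (⊤ : Submodule R M)) : IsSMulRegular M y := by
  have hle : powerTorsion I M ≤ Ideal.span {y} • powerTorsion I M := by
    intro v hv
    obtain ⟨w, rfl⟩ := mem_smul_top_iff.1 (h hv)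
    exact Submodule.smul_mem_smul (Ideal.mem_span_singleton_self y)
      (hy.mem_powerTorsion_of_smul_mem hv)
  have hspan : Ideal.span {y} ≤ (⊥ : Ideal R).jacobson :=
    ((Ideal.span_singleton_le_iff_mem _).2 hym).trans (maximalIdeal_le_jacobson _)
  have hbot := Submodule.eq_bot_of_le_smul_of_le_jacobson_bot _ _ (IsNoetherian.noetherian _)
    hle hspan
  obtain ⟨c, hc⟩ := hy
  refine isSMulRegular_iff_right_eq_zero_of_smul.2 fun v hv => ?_
  exact (Submodule.mem_bot R).1 (hbot ▸ mem_powerTorsion_iff.2 ⟨c, hc v hv⟩)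

theorem mem_range_of_forall_mem_pow_smul_mem_range {g : M →ₗ[R] N} (hg : Function.Injective g)
    {a b : R} (haI : a ∈ I) (hbI : b ∈ I) (ha : IsSMulRegular N a)
    (hb : IsSMulRegular (QuotSMulTop a M) b) {n : ℕ} {q : N}
    (hq : ∀ r ∈ I ^ n, r • q ∈ g.range) : q ∈ g.range := by
  induction n generalizing q with
  | zero => simpa using hq 1 (by simp)
  | succ n ih =>
    have hmul : ∀ s ∈ I, s • q ∈ g.range := fun s hs => ih fun r hr => by
      rw [← mul_smul]
      exact hq _ (pow_succ I n ▸ Ideal.mul_mem_mul hr hs)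
    exact mem_range_of_smul_mem_range hg ha hb (hmul a haI) (hmul b hbI)

end PowerTorsion

section QuotientBySuperficial

variable {R : Type*} [CommRing R] {M E : Type*} [AddCommGroup M] [Module R M] [AddCommGroup E]
  [Module R E] {f : M →ₗ[R] E} {y : R} {I : Ideal R}

/-- The embedding `M / (M ∩ y E) → E / y E` induced by an embedding `f : M → E`. -/
def quotComapMap (f : M →ₗ[R] E) (y : R) :
    (M ⧸ (y • (⊤ : Submodule R E)).comap f) →ₗ[R] QuotSMulTop y E :=
  Submodule.mapQ _ _ f le_rfl

theorem quotComapMap_injective (f : M →ₗ[R] E) (y : R) :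
    Function.Injective (quotComapMap f y) := by
  rw [← LinearMap.ker_eq_bot, quotComapMap, Submodule.mapQ, Submodule.ker_liftQ,
    LinearMap.ker_comp, Submodule.ker_mkQ, Submodule.mkQ_map_self]

theorem smul_top_le_comap_smul_top (f : M →ₗ[R] E) (y : R) :
    y • (⊤ : Submodule R M) ≤ (y • (⊤ : Submodule R E)).comap f := by
  intro v hv
  obtain ⟨w, rfl⟩ := mem_smul_top_iff.1 hv
  exact mem_smul_top_iff.2 ⟨f w, (map_smul f y w).symm⟩

theorem span_singleton_sup_le_sup_annihilator_quotient {N : Submodule R M}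
    (hN : y • (⊤ : Submodule R M) ≤ N) :
    Ideal.span {y} ⊔ I ≤ I ⊔ Module.annihilator R (M ⧸ N) := by
  rw [sup_comm, Submodule.annihilator_quotient]
  exact sup_le_sup_left ((Ideal.span_singleton_le_iff_mem _).2
    (Submodule.mem_colon.2 fun v _ => hN (mem_smul_top_iff.2 ⟨v, rfl⟩))) _

theorem IsFilterRegular.exists_pow_smul_comap_le (hf : Function.Injective f)
    (hy : IsFilterRegular I (E ⧸ f.range) y) :
    ∃ c : ℕ, I ^ c • (y • (⊤ : Submodule R E)).comap f ≤ y • (⊤ : Submodule R M) := by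
  obtain ⟨c, hc⟩ := hy
  refine ⟨c, Submodule.smul_le.2 fun b hb v hv => ?_⟩
  obtain ⟨e, he⟩ := mem_smul_top_iff.1 hv
  have hye : y • f.range.mkQ e = 0 := by
    rw [← map_smul, he, Submodule.mkQ_apply, Submodule.Quotient.mk_eq_zero]
    exact LinearMap.mem_range_self f v
  have hbe := hc _ hye b hb
  rw [← map_smul, Submodule.mkQ_apply, Submodule.Quotient.mk_eq_zero] at hbe
  obtain ⟨m, hm⟩ := hbe
  refine mem_smul_top_iff.2 ⟨m, hf ?_⟩
  rw [map_smul, map_smul, hm, ← he, smul_comm]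

theorem comap_smul_top_le_of_isSMulRegular_quotient (hf : Function.Injective f)
    (hy : IsSMulRegular (E ⧸ f.range) y) :
    (y • (⊤ : Submodule R E)).comap f ≤ y • (⊤ : Submodule R M) := by
  have hfilter : IsFilterRegular ⊤ (E ⧸ f.range) y :=
    ⟨0, fun v hv b _ => by rw [hy.right_eq_zero_of_smul hv, smul_zero]⟩
  obtain ⟨c, hc⟩ := hfilter.exists_pow_smul_comap_le hf
  rwa [Ideal.top_pow, Submodule.top_smul] at hc

theorem powerTorsion_quotient_range_le {a b : R} (haI : a ∈ I) (hbI : b ∈ I)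
    (ha : IsSMulRegular (QuotSMulTop y E) a)
    (hb : IsSMulRegular (QuotSMulTop a (M ⧸ (y • (⊤ : Submodule R E)).comap f)) b) :
    powerTorsion I (E ⧸ f.range) ≤ y • ⊤ := by
  intro v hv
  obtain ⟨e, rfl⟩ := f.range.mkQ_surjective v
  obtain ⟨n, hn⟩ := mem_powerTorsion_iff.1 hv
  have hrange : ∀ r ∈ I ^ n, r • (y • (⊤ : Submodule R E)).mkQ e ∈ (quotComapMap f y).range := by
    intro r hr
    have hre := hn r hr
    rw [← map_smul, Submodule.mkQ_apply, Submodule.Quotient.mk_eq_zero] at hre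
    obtain ⟨m, hm⟩ := hre
    exact ⟨Submodule.mkQ _ m, congrArg (Submodule.mkQ _) hm⟩
  obtain ⟨m, hm⟩ := mem_range_of_forall_mem_pow_smul_mem_range (quotComapMap_injective f y) haI hbI
    ha hb hrange
  obtain ⟨m, rfl⟩ := Submodule.mkQ_surjective _ m
  obtain ⟨w, hw⟩ := mem_smul_top_iff.1 ((Submodule.Quotient.eq _).1 hm.symm)
  refine mem_smul_top_iff.2 ⟨f.range.mkQ w, ?_⟩
  rw [← map_smul, hw, map_sub, sub_eq_self, Submodule.mkQ_apply, Submodule.Quotient.mk_eq_zero]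
  exact LinearMap.mem_range_self f m

theorem IsFilterRegular.comap_smul_top_le [IsLocalRing R] [IsNoetherian R E]
    (hf : Function.Injective f) (hy : IsFilterRegular I (E ⧸ f.range) y) (hym : y ∈ maximalIdeal R)
    {a b : R} (haI : a ∈ I) (hbI : b ∈ I) (ha : IsSMulRegular (QuotSMulTop y E) a)
    (hb : IsSMulRegular (QuotSMulTop a (M ⧸ (y • (⊤ : Submodule R E)).comap f)) b) :
    (y • (⊤ : Submodule R E)).comap f ≤ y • (⊤ : Submodule R M) :=
  comap_smul_top_le_of_isSMulRegular_quotient hf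
    (hy.isSMulRegular hym (powerTorsion_quotient_range_le haI hbI ha hb))

end QuotientBySuperficial

section Engine

variable {R : Type*} [CommRing R] [IsLocalRing R] [IsNoetherianRing R]

theorem IsIdealOfDefinition.length_quotient_comap_ne_top {M : Type*} [AddCommGroup M] [Module R M]
    [Module.Finite R M] {I : Ideal R} (hI : IsIdealOfDefinition M I) {N T : Submodule R M} {c : ℕ}
    (hc : I ^ c • N ≤ T) : Module.length R (N ⧸ T.comap N.subtype) ≠ ⊤ := by
  refine (hI.pow c).length_ne_top (fun b hb => ?_)
    ((LinearMap.annihilator_le_of_injective N.subtype N.injective_subtype).trans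
      (LinearMap.annihilator_le_of_surjective _ (Submodule.mkQ_surjective _)))
  rw [Submodule.annihilator_quotient, Submodule.mem_colon]
  exact fun v _ => hc (Submodule.smul_mem_smul hb v.2)

theorem eventually_hilbertFunction_succ {M : Type*} [AddCommGroup M] [Module R M]
    [Module.Finite R M] {I : Ideal R} (hI : IsIdealOfDefinition M I) {y : R} (hyI : y ∈ I)
    (hreg : IsSMulRegular M y) (hsup : IsSuperficial I M y) {N : Submodule R M} (hyN : y • ⊤ ≤ N)
    {c : ℕ} (hc : I ^ c • N ≤ y • (⊤ : Submodule R M)) :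
    ∀ᶠ n in atTop, hilbertFunction M I (n + 1) = hilbertFunction M I n +
      ((Module.length R (N ⧸ (y • (⊤ : Submodule R M)).comap N.subtype)).toNat +
        hilbertFunction (M ⧸ N) I (n + 1)) := by
  have hIN : IsIdealOfDefinition (M ⧸ N) I :=
    hI.mono le_sup_left (LinearMap.annihilator_le_of_surjective _ (Submodule.mkQ_surjective _))
  filter_upwards [eventually_length_quotient_pow_succ hyI hreg hsup hyN hc] with n hn
  have hM := (hI.pow n).length_quotient_ne_top
  have hMN := (hIN.pow (n + 1)).length_quotient_ne_top
  have hN := hI.length_quotient_comap_ne_top hc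
  have hsum : Module.length R (N ⧸ (y • (⊤ : Submodule R M)).comap N.subtype) +
      Module.length R ((M ⧸ N) ⧸ (I ^ (n + 1) • ⊤ : Submodule R (M ⧸ N))) ≠ ⊤ :=
    WithTop.add_ne_top.2 ⟨hN, hMN⟩
  rw [hilbertFunction, hn, ENat.toNat_add hM hsum, ENat.toNat_add hN hMN]
  push_cast
  rfl

theorem hilbertFunction_span_singleton {M : Type*} [AddCommGroup M] [Module R M]
    [Module.Finite R M] {y : R} (hreg : IsSMulRegular M y)
    (hI : IsIdealOfDefinition M (Ideal.span {y})) (n : ℕ) :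
    hilbertFunction M (Ideal.span {y}) n = n * hilbertFunction M (Ideal.span {y}) 1 := by
  set I := Ideal.span {y} with hIy
  induction n with
  | zero => simp [hilbertFunction, Submodule.Quotient.subsingleton_iff]
  | succ n ih =>
    have hcolon : (I ^ (n + 1) • ⊤ : Submodule R M).comap (LinearMap.lsmul R M y) = I ^ n • ⊤ := by
      have hsmul : (I ^ (n + 1) • ⊤ : Submodule R M) = y • (I ^ n • (⊤ : Submodule R M)) := by
        rw [pow_succ', mul_smul, hIy, Submodule.ideal_span_singleton_smul]
      rw [hsmul]
      exact Submodule.comap_map_eq_of_injective (f := LinearMap.lsmul R M y) hreg _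
    have hrange : (I ^ (n + 1) • ⊤ : Submodule R M) ⊔ (LinearMap.lsmul R M y).range =
        I ^ 1 • ⊤ := by
      have htop : (LinearMap.lsmul R M y).range = I ^ 1 • (⊤ : Submodule R M) := by
        rw [pow_one, hIy, Submodule.ideal_span_singleton_smul]
        exact LinearMap.range_eq_map _
      rw [htop, sup_eq_right]
      exact Submodule.smul_mono_left (Ideal.pow_le_pow_right (by lia))
    rw [hilbertFunction, length_quotient_eq_add_of_comap_eq hcolon, hrange,
      ENat.toNat_add (hI.pow n).length_quotient_ne_top (hI.pow 1).length_quotient_ne_top,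
      Nat.cast_add, Nat.cast_succ, add_mul, one_mul, ← ih]
    rfl

theorem exists_hilbertFunction_eventuallyEq_succ {M : Type*} [AddCommGroup M] [Module R M]
    [Module.Finite R M] {I : Ideal R} (hI : IsIdealOfDefinition M I) {y : R} (hyI : y ∈ I)
    (hreg : IsSMulRegular M y) (hsup : IsSuperficial I M y) {N : Submodule R M} (hyN : y • ⊤ ≤ N)
    {c : ℕ} (hc : I ^ c • N ≤ y • (⊤ : Submodule R M)) {d : ℕ} (hd : 1 ≤ d) {e' : ℕ → ℤ}
    (he' : hilbertFunction (M ⧸ N) I =ᶠ[atTop] hilbertSum d e') :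
    ∃ e : ℕ → ℤ, hilbertFunction M I =ᶠ[atTop] hilbertSum (d + 1) e ∧ e 1 ≤ e' 1 ∧
      (d = 1 → e 1 = e' 1 → N ≤ y • ⊤) := by
  obtain ⟨e, he, helt, hed⟩ := exists_eventuallyEq_hilbertSum_succ he'
    (eventually_hilbertFunction_succ hI hyI hreg hsup hyN hc)
  refine ⟨e, he, ?_⟩
  rcases hd.eq_or_lt with rfl | hd
  · refine ⟨by lia, fun _ heq => ?_⟩
    have hlen := (ENat.toNat_eq_zero.1 (by lia)).resolve_right (hI.length_quotient_comap_ne_top hc)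
    rwa [Module.length_eq_zero_iff, Submodule.Quotient.subsingleton_iff,
      Submodule.comap_subtype_eq_top] at hlen
  · exact ⟨(helt 1 hd).le, fun h => absurd h hd.ne'⟩

theorem exists_superficial [Infinite (ResidueField R)] (M C : Type*) [AddCommGroup M] [Module R M]
    [Module.Finite R M] [AddCommGroup C] [Module R C] [Module.Finite R C] (x : R) (J : Ideal R) :
    ∃ y, Ideal.span {y} ⊔ J = Ideal.span {x} ⊔ J ∧
      IsSuperficial (Ideal.span {x} ⊔ J) M y ∧ IsFilterRegular (Ideal.span {x} ⊔ J) C y := by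
  set I := Ideal.span {x} ⊔ J
  have := genericFilter_neBot (R := R) I
  have hI : Ideal.span (Set.range I.subtype) = I := by simp
  have hfilter := eventually_isFilterRegular (M := C) I.subtype
  rw [hI] at hfilter
  obtain ⟨y, hy, hsup, hfilter⟩ := ((eventually_span_singleton_sup_eq rfl).and
    ((eventually_isSuperficial (M := M) I).and hfilter)).exists
  exact ⟨y, hy, hsup, hfilter⟩

variable {M E : Type*} [AddCommGroup M] [Module R M] [AddCommGroup E] [Module R E]
  [Module.Finite R E]

theorem isWeaklyRegular_cons_of_quotient [Module.Finite R M] {x y : R} {xs : List R}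
    (hmem : ∀ z ∈ x :: xs, z ∈ maximalIdeal R) (hym : y ∈ maximalIdeal R)
    (hy : Ideal.span {y} ⊔ Ideal.ofList xs = Ideal.span {x} ⊔ Ideal.ofList xs)
    (hreg : IsSMulRegular M y) {N : Submodule R M} (hN : N = y • ⊤)
    (h : IsWeaklyRegular (M ⧸ N) xs) :
    IsWeaklyRegular M (x :: xs) := by
  obtain ⟨hx, hxs⟩ := List.forall_mem_cons.1 hmem
  subst hN
  have hcons : IsWeaklyRegular M (y :: xs) := (isWeaklyRegular_cons_iff M y xs).2 ⟨hreg, h⟩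
  exact isWeaklyRegular_cons_of_mem_span_sup hcons hym hx hxs
    (hy.le (Ideal.mem_sup_left (Ideal.mem_span_singleton_self y)))

theorem exists_hilbertFunction_span_singleton_eventuallyEq [Module.Finite R M] {y : R}
    (hreg : IsSMulRegular M y) (hI : IsIdealOfDefinition M (Ideal.span {y})) :
    ∃ e : ℕ → ℤ, hilbertFunction M (Ideal.span {y}) =ᶠ[atTop] hilbertSum 1 e ∧ e 1 = 0 := by
  refine ⟨fun i => if i = 0 then hilbertFunction M (Ideal.span {y}) 1 else 0,
    .of_forall fun n => ?_, rfl⟩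
  rw [hilbertFunction_span_singleton hreg hI]
  simp [hilbertSum, mul_comm]

theorem exists_hilbertFunction_eventuallyEq_of_infinite [Infinite (ResidueField R)] {x : R}
    {xs : List R} {f : M →ₗ[R] E} (hf : Function.Injective f)
    (hmem : ∀ z ∈ x :: xs, z ∈ maximalIdeal R)
    (hE : IsWeaklyRegular E (x :: xs)) (hI : IsIdealOfDefinition M (Ideal.ofList (x :: xs))) :
    ∃ e : ℕ → ℤ, hilbertFunction M (Ideal.ofList (x :: xs)) =ᶠ[atTop] hilbertSum (xs.length + 1) e ∧
      e 1 ≤ 0 ∧ (e 1 = 0 → IsWeaklyRegular M (x :: xs)) := by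
  induction xs generalizing x M E with
  | nil =>
    have : Module.Finite R M := .of_injective f hf
    have hreg : IsSMulRegular M x := .of_injective f hf ((isWeaklyRegular_singleton_iff E x).1 hE)
    rw [Ideal.ofList_singleton] at hI ⊢
    obtain ⟨e, he, he1⟩ := exists_hilbertFunction_span_singleton_eventuallyEq hreg hI
    exact ⟨e, he, he1.le, fun _ => (isWeaklyRegular_singleton_iff M x).2 hreg⟩
  | cons a xs ih =>
    have : Module.Finite R M := .of_injective f hf
    obtain ⟨hx, hxs⟩ := List.forall_mem_cons.1 hmem
    have hIm : Ideal.ofList (x :: a :: xs) ≤ maximalIdeal R := Ideal.span_le.2 hmem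
    rw [Ideal.ofList_cons] at hI hIm ⊢
    obtain ⟨y, hspan, hsup, hfilter⟩ :=
      exists_superficial M (E ⧸ f.range) x (Ideal.ofList (a :: xs))
    set I := Ideal.span {x} ⊔ Ideal.ofList (a :: xs)
    have hyI : y ∈ I := hspan.le (Ideal.mem_sup_left (Ideal.mem_span_singleton_self y))
    have hyE := isWeaklyRegular_cons_of_mem_span_sup hE hx (hIm hyI) hxs
      (hspan.ge (Ideal.mem_sup_left (Ideal.mem_span_singleton_self x)))
    rw [isWeaklyRegular_cons_iff] at hyE
    have hyM : IsSMulRegular M y := .of_injective f hf hyE.1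
    set N := (y • (⊤ : Submodule R E)).comap f
    have hyN : y • ⊤ ≤ N := smul_top_le_comap_smul_top f y
    obtain ⟨c, hc⟩ := hfilter.exists_pow_smul_comap_le hf
    have hIN := hspan.ge.trans (span_singleton_sup_le_sup_annihilator_quotient hyN)
    obtain ⟨e', he', he'1, hreg'⟩ := ih (quotComapMap_injective f y) hxs hyE.2
      (hI.mono hIN (LinearMap.annihilator_le_of_surjective _ N.mkQ_surjective))
    rw [← hilbertFunction_eq_of_le_sup_annihilator le_sup_right hIN] at he'
    obtain ⟨e, he, hle, hNle⟩ :=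
      exists_hilbertFunction_eventuallyEq_succ hI hyI hyM hsup hyN hc (by simp) he'
    refine ⟨e, he, hle.trans he'1, fun he1 => ?_⟩
    have hregN : IsWeaklyRegular (M ⧸ N) (a :: xs) := hreg' (by lia)
    refine isWeaklyRegular_cons_of_quotient hmem (hIm hyI) hspan hyM (le_antisymm ?_ hyN) hregN
    rcases xs with _ | ⟨b, xs⟩
    · exact hNle rfl (by lia)
    · have ha := ((isWeaklyRegular_cons_iff _ _ _).1 hyE.2).1
      have hb := ((isWeaklyRegular_cons_iff _ _ _).1 ((isWeaklyRegular_cons_iff _ _ _).1 hregN).2).1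
      refine hfilter.comap_smul_top_le hf (hIm hyI) (Ideal.mem_sup_right ?_)
        (Ideal.mem_sup_right ?_) ha hb
      all_goals exact Ideal.subset_span (by simp)

end Engine

section RationalExtension

instance isPrime_map_C_maximalIdeal (R : Type*) [CommRing R] [IsLocalRing R] :
    ((maximalIdeal R).map (Polynomial.C : R →+* R[X])).IsPrime :=
  Ideal.isPrime_map_C_of_isPrime

/-- The local ring `R(t)`: the localization of `R[t]` at the extension of the maximal ideal. It is
flat over `R`, its maximal ideal is extended from `R`, and its residue field is infinite. -/
abbrev RationalExtension (R : Type*) [CommRing R] [IsLocalRing R] : Type _ :=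
  Localization.AtPrime ((maximalIdeal R).map (Polynomial.C : R →+* R[X]))

namespace RationalExtension

variable (R : Type*) [CommRing R] [IsLocalRing R]

theorem map_maximalIdeal :
    (maximalIdeal R).map (algebraMap R (RationalExtension R)) =
      maximalIdeal (RationalExtension R) := by
  rw [IsScalarTower.algebraMap_eq R R[X] (RationalExtension R), ← Ideal.map_map,
    Polynomial.algebraMap_eq, Localization.AtPrime.map_eq_maximalIdeal]

instance isLocalHom_algebraMap : IsLocalHom (algebraMap R (RationalExtension R)) :=
  ((local_hom_TFAE (algebraMap R (RationalExtension R))).out 0 2).2 (map_maximalIdeal R).le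

instance flat : Module.Flat R (RationalExtension R) :=
  .trans R R[X] _

instance isNoetherianRing [IsNoetherianRing R] : IsNoetherianRing (RationalExtension R) :=
  IsLocalization.isNoetherianRing
    ((maximalIdeal R).map (Polynomial.C : R →+* R[X])).primeCompl _ inferInstance

instance infinite_residueField : Infinite (ResidueField (RationalExtension R)) := by
  refine Infinite.of_injective
    (fun n : ℕ => residue (RationalExtension R) (algebraMap R[X] _ (Polynomial.X ^ n)))
    fun i j hij => ?_
  by_contra hne
  have hmem : (Polynomial.X ^ i - Polynomial.X ^ j : R[X]) ∈
      (maximalIdeal R).map (Polynomial.C : R →+* R[X]) := by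
    rwa [← IsLocalization.AtPrime.to_map_mem_maximal_iff (RationalExtension R)
      ((maximalIdeal R).map (Polynomial.C : R →+* R[X])), ← residue_eq_zero_iff, map_sub, map_sub,
      sub_eq_zero]
  have hcoeff := Ideal.mem_map_C_iff.1 hmem i
  rw [Polynomial.coeff_sub, Polynomial.coeff_X_pow_self, Polynomial.coeff_X_pow, if_neg hne,
    sub_zero] at hcoeff
  exact (Ideal.ne_top_iff_one _).1 (maximalIdeal.isMaximal R).ne_top hcoeff

end RationalExtension

end RationalExtension

section BaseChange

variable {R : Type*} [CommRing R] {S : Type*} [CommRing S] [Algebra R S] {M : Type*}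
  [AddCommGroup M] [Module R M]

theorem isWeaklyRegular_of_isWeaklyRegular_tensorProduct [Module.FaithfullyFlat R S] {xs : List R}
    (h : IsWeaklyRegular (S ⊗[R] M) (xs.map (algebraMap R S))) : IsWeaklyRegular M xs := by
  induction xs generalizing M with
  | nil => exact .nil R M
  | cons x xs ih =>
    rw [List.map_cons, isWeaklyRegular_cons_iff] at h
    have hx : IsSMulRegular (S ⊗[R] M) x := fun v w hvw => h.1 (by simpa using hvw)
    exact (isWeaklyRegular_cons_iff M x xs).2
      ⟨.of_injective (TensorProduct.mk R S M 1)
        (Module.FaithfullyFlat.tensorProduct_mk_injective M) hx,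
      ih (((QuotSMulTop.algebraMapTensorEquivTensorQuotSMulTop x M S).isWeaklyRegular_congr _).1
        h.2)⟩

variable [IsLocalRing R] [IsLocalRing S] [Module.Flat R S] [IsLocalHom (algebraMap R S)]

theorem length_quotient_map_smul_top
    (hS : (maximalIdeal R).map (algebraMap R S) = maximalIdeal S) (I : Ideal R) :
    Module.length S ((S ⊗[R] M) ⧸ (I.map (algebraMap R S) • ⊤ : Submodule S (S ⊗[R] M))) =
      Module.length R (M ⧸ (I • ⊤ : Submodule R M)) := by
  have : IsSimpleModule S (S ⧸ maximalIdeal S) :=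
    isSimpleModule_iff_isCoatom.2 (maximalIdeal.isMaximal S).out
  rw [(TensorProduct.tensorQuotMapSMulEquivTensorQuot M S I).length_eq,
    IsLocalRing.length_baseChange, hS, Module.length_eq_one S (S ⧸ maximalIdeal S), mul_one]

theorem hilbertFunction_tensorProduct
    (hS : (maximalIdeal R).map (algebraMap R S) = maximalIdeal S) (I : Ideal R) :
    hilbertFunction (S ⊗[R] M) (I.map (algebraMap R S)) = hilbertFunction M I := by
  funext n
  rw [hilbertFunction, hilbertFunction, ← Ideal.map_pow, length_quotient_map_smul_top hS]

theorem IsIdealOfDefinition.tensorProduct [IsNoetherianRing R] [IsNoetherianRing S]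
    [Module.Finite R M] (hS : (maximalIdeal R).map (algebraMap R S) = maximalIdeal S) {I : Ideal R}
    (hI : IsIdealOfDefinition M I) : IsIdealOfDefinition (S ⊗[R] M) (I.map (algebraMap R S)) :=
  isIdealOfDefinition_of_length_ne_top
    ((length_quotient_map_smul_top hS I).trans_ne hI.length_quotient_ne_top)

theorem exists_hilbertFunction_eventuallyEq_of_flat [IsNoetherianRing R] [IsNoetherianRing S]
    [Infinite (ResidueField S)] (hS : (maximalIdeal R).map (algebraMap R S) = maximalIdeal S)
    {E : Type*} [AddCommGroup E] [Module R E] [Module.Finite R E] {x : R} {xs : List R}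
    {f : M →ₗ[R] E} (hf : Function.Injective f) (hmem : ∀ z ∈ x :: xs, z ∈ maximalIdeal R)
    (hE : IsWeaklyRegular E (x :: xs)) (hI : IsIdealOfDefinition M (Ideal.ofList (x :: xs))) :
    ∃ e : ℕ → ℤ,
      hilbertFunction M (Ideal.ofList (x :: xs)) =ᶠ[atTop] hilbertSum (xs.length + 1) e ∧
        e 1 ≤ 0 ∧ (e 1 = 0 → IsWeaklyRegular M (x :: xs)) := by
  have : Module.FaithfullyFlat R S := .of_flat_of_isLocalHom
  have : Module.Finite R M := .of_injective f hf
  have hmemS : ∀ z ∈ (x :: xs).map (algebraMap R S), z ∈ maximalIdeal S :=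
    List.forall_mem_map.2 fun z hz => hS ▸ Ideal.mem_map_of_mem _ (hmem z hz)
  have hIS := hI.tensorProduct hS
  rw [Ideal.map_ofList] at hIS
  obtain ⟨e, he, he1, hreg⟩ := exists_hilbertFunction_eventuallyEq_of_infinite
    (f := f.baseChange S) (Module.Flat.lTensor_preserves_injective_linearMap f hf) hmemS
    (hE.of_flat_of_isBaseChange (TensorProduct.isBaseChange R E S)) hIS
  rw [← List.map_cons, ← Ideal.map_ofList, hilbertFunction_tensorProduct hS, List.length_map] at he
  exact ⟨e, he, he1, fun h => isWeaklyRegular_of_isWeaklyRegular_tensorProduct (hreg h)⟩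

end BaseChange

section CohenMacaulay

theorem ofList_ofFn {R : Type*} [CommRing R] {n : ℕ} (x : Fin n → R) :
    Ideal.ofList (List.ofFn x) = Ideal.span (Set.range x) :=
  congrArg Ideal.span (Set.ext fun _ => List.mem_ofFn)

variable {R : Type*} [CommRing R] [IsLocalRing R] {M : Type*} [AddCommGroup M] [Module R M]

theorem DepthGE.of_le_depth {n : ℕ} (h : n ≤ depth R M) : DepthGE R n M := by
  rcases n with _ | n
  · exact depthGE_zero
  obtain ⟨_, ⟨rs, rfl, hmem, hrs⟩, hlt⟩ := lt_sSup_iff.1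
    (lt_of_lt_of_le (Nat.cast_lt.2 n.lt_succ_self) h)
  have hlen : n + 1 ≤ rs.length := Nat.cast_lt.1 hlt
  have htake := hrs.toIsWeaklyRegular
  rw [← rs.take_append_drop (n + 1), isWeaklyRegular_append_iff] at htake
  exact ⟨rs.take (n + 1), List.length_take_of_le hlen, fun r hr => hmem r (List.mem_of_mem_take hr),
    htake.1⟩

theorem IsCohenMacaulayModule.depthGE (h : IsCohenMacaulayModule R M) :
    DepthGE R (moduleDim R M) M := by
  rcases h.2 with hE | hdepth
  · exact .of_le_depth (by simp [moduleDim, Module.supportDim_eq_bot_of_subsingleton])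
  · refine .of_le_depth ?_
    rw [moduleDim, ← hdepth]
    exact ENat.natCast_toNat_le_self _

variable [IsNoetherianRing R]

theorem natCast_moduleDim [Nontrivial M] :
    (moduleDim R M : WithBot ℕ∞) = Module.supportDim R M := by
  obtain ⟨n, hn⟩ := WithBot.ne_bot_iff_exists.1 (Module.supportDim_ne_bot_of_nontrivial R M)
  have htop : (n : WithBot ℕ∞) < ⊤ :=
    hn.trans_lt ((Module.supportDim_le_ringKrullDim R M).trans_lt ringKrullDim_lt_top)
  obtain ⟨m, rfl⟩ := ENat.ne_top_iff_exists.1 (WithBot.coe_lt_coe.1 htop).ne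
  rw [moduleDim, ← hn]
  rfl

theorem IsCohenMacaulayModule.moduleDim_eq_of_injective {E : Type*} [AddCommGroup E] [Module R E]
    (h : IsCohenMacaulayModule R E) [Nontrivial M] {f : M →ₗ[R] E} (hf : Function.Injective f) :
    moduleDim R M = moduleDim R E := by
  have : Module.Finite R E := h.1
  have : Nontrivial E := hf.nontrivial
  have hle := h.depthGE.le_supportDim hf
  rw [natCast_moduleDim] at hle
  rw [moduleDim, moduleDim, le_antisymm (Module.supportDim_le_of_injective f hf) hle]

theorem IsParameterIdeal.of_annihilator_le {N : Type*} [AddCommGroup N] [Module R N]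
    [Module.Finite R M] [Module.Finite R N] {J : Ideal R} (h : IsParameterIdeal R M J)
    (hdim : moduleDim R M = moduleDim R N)
    (hann : Module.annihilator R M ≤ Module.annihilator R N) : IsParameterIdeal R N J :=
  ⟨h.1, hdim ▸ h.2.1,
    ((isIdealOfDefinition_of_length_ne_top h.2.2).mono le_sup_left hann).length_quotient_ne_top⟩

variable [Module.Finite R M]

theorem isCohenMacaulayModule_of_isWeaklyRegular {xs : List R}
    (hxs : ∀ x ∈ xs, x ∈ maximalIdeal R) (hdim : Module.supportDim R M ≤ xs.length)
    (h : IsWeaklyRegular M xs) : IsCohenMacaulayModule R M := by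
  refine ⟨inferInstance, or_iff_not_imp_left.2 fun hM => ?_⟩
  rw [not_subsingleton_iff_nontrivial] at hM
  have hle {rs : List R} (hmem : ∀ r ∈ rs, r ∈ maximalIdeal R) (hrs : IsWeaklyRegular M rs) :
      (rs.length : WithBot ℕ∞) ≤ Module.supportDim R M :=
    DepthGE.le_supportDim ⟨rs, rfl, hmem, hrs⟩ (g := LinearMap.id) Function.injective_id
  have hdepth : depth R M = xs.length := by
    refine le_antisymm (sSup_le ?_)
      (le_sSup ⟨xs, rfl, hxs, .of_isWeaklyRegular_of_mem_maximalIdeal M hxs h⟩)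
    rintro _ ⟨rs, rfl, hmem, hrs⟩
    exact_mod_cast (hle hmem hrs.toIsWeaklyRegular).trans hdim
  rw [hdepth]
  exact le_antisymm (hle hxs h) hdim

theorem IsParameterIdeal.exists_list {J : Ideal R} (hJ : IsParameterIdeal R M J) :
    ∃ xs : List R, xs.length = moduleDim R M ∧ (∀ x ∈ xs, x ∈ maximalIdeal R) ∧
      J = Ideal.ofList xs ∧ IsIdealOfDefinition M (Ideal.ofList xs) := by
  obtain ⟨hJm, ⟨x, rfl⟩, hlen⟩ := hJ
  rw [← ofList_ofFn] at hJm hlen ⊢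
  exact ⟨List.ofFn x, List.length_ofFn, fun r hr => hJm (Ideal.subset_span hr), rfl,
    isIdealOfDefinition_of_length_ne_top hlen⟩

end CohenMacaulay

end LocalHilbert

open LocalHilbert IsLocalRing RingTheory.Sequence in
theorem mainTheorem2_general {R : Type*} [CommRing R] [IsLocalRing R] [IsNoetherianRing R]
    {M E : Type*} [AddCommGroup M] [Module R M] [AddCommGroup E] [Module R E]
    (hE : IsCohenMacaulayModule R E) {f : M →ₗ[R] E} (hf : Function.Injective f)
    (hM : ¬ IsCohenMacaulayModule R M) {J : Ideal R} (hJ : IsParameterIdeal R E J) :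
    hilbertCoeff R M J 1 < 0 := by
  have : Module.Finite R E := hE.1
  have : Module.Finite R M := .of_injective f hf
  obtain ⟨xs, hlen, hmem, rfl, hIE⟩ := hJ.exists_list
  have hI : IsIdealOfDefinition M (Ideal.ofList xs) :=
    hIE.mono le_sup_left (f.annihilator_le_of_injective hf)
  have hregM : ¬ IsWeaklyRegular M xs :=
    mt (isCohenMacaulayModule_of_isWeaklyRegular hmem (supportDim_le_length hmem hI)) hM
  have hregE : IsWeaklyRegular E xs := (hlen ▸ hE.depthGE).isWeaklyRegular hmem hIE
  have : Nontrivial M := not_subsingleton_iff_nontrivial.1 fun h => hM ⟨inferInstance, .inl h⟩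
  have hdim : moduleDim R M = xs.length := (hE.moduleDim_eq_of_injective hf).trans hlen.symm
  rcases xs with _ | ⟨x, xs⟩
  · exact absurd (.nil R M) hregM
  obtain ⟨e, he, he1, hreg⟩ := exists_hilbertFunction_eventuallyEq_of_flat
    (RationalExtension.map_maximalIdeal R) hf hmem hregE hI
  rw [hilbertCoeff_eq_of_eventuallyEq hI (by rwa [hdim]) (by simp [hdim])]
  exact he1.lt_of_ne (mt hreg hregM)

theorem mainTheorem2 {R : Type*} [CommRing R] [IsLocalRing R] [IsNoetherianRing R]
    (d : ℕ) (hd : 2 ≤ d) (hdim : ringKrullDim R = d)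
    {E : Type*} [AddCommGroup E] [Module R E]
    (hE : LocalHilbert.IsMaximalCohenMacaulayModule R E)
    (f : R →ₗ[R] E) (hf : Function.Injective f)
    (hR : ¬ LocalHilbert.IsCohenMacaulayLocalRing R)
    (J : Ideal R) (hJ : LocalHilbert.IsParameterIdeal R R J) :
    LocalHilbert.hilbertCoeff R R J 1 < 0 := by
  have : Module.Finite R E := hE.1.1
  have hann : Module.annihilator R R = ⊥ := Module.annihilator_eq_bot.2 inferInstance
  exact mainTheorem2_general hE.1 hf hR
    (hJ.of_annihilator_le (hE.1.moduleDim_eq_of_injective hf) (hann.le.trans bot_le))
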